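/- Let $n,d\ge 0$. The complete split graph $S_{n,d}$ has a sink $s$, clique vertices $v_1,\dots,v_n$ and independent vertices $w_1,\dots,w_d$; any two distinct vertices are joined by an edge, except two independent vertices. A configuration $c=(a_1,\dots,a_n;b_1,\dots,b_d)$ assigns a number of grains in $\mathbb N$ to each non-sink vertex ($a_j$ to $v_j$, $b_i$ to $w_i$). A non-sink vertex is unstable if it has at least as many grains as its degree; toppling it sends one grain to each neighbour (the sink absorbs grains). A stable configuration is recurrent if it can be reached from every configuration by adding grains and toppling unstable vertices. It is sorted if $a_1\ge\dots\ge a_n$ and $b_1\ge\dots\ge b_d$. Let $\mathrm{level}(c)=\sum_j a_j+\sum_i b_i-\binom{n+d}{2}+\binom d2$. ITC toppling of a sorted recurrent $c$: add one grain to every neighbour of the sink; then repeat, until the configuration is stable, the loop consisting of toppling in parallel all unstable independent vertices and then toppling in parallel all unstable clique vertices. If $q'_i$ and $p'_i$ are the numbers of independent and clique vertices toppled in the $i$th of the $t$ loops, put $\mathrm{wtopple}_{ITC}(c)=\sum_{i=1}^t i\,(q'_i+p'_i)$. Let $\mathrm{Schr}_{n,d}$ be the set of words with $n$ letters $U$,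 $n$ letters $D$ and $d$ letters $H$, every prefix of which has at least as many $U$'s as $D$'s, viewed as lattice paths from $(0,0)$ to $(n+d,n+d)$ with steps $U=(0,1)$, $H=(1,1)$, $D=(1,0)$. For $p\in \mathrm{Schr}_{n,d}$ let $\phi(p)=(a_1,\dots,a_n;b_1,\dots,b_d)$, where $a_j+1$ is the number of letters other than $U$ following the $j$th $U$, and $b_i$ is the number of $D$'s following the $i$th $H$. The mirror map $\mu$ reverses a word and exchanges the letters $U$ and $D$. The area of $p$ is the number of triangles with vertices $(i,j),(i+1,j),(i+1,j+1)$, $i,j\in\mathbb N$, lying between $p$ and the diagonal $y=x$. Let $C(p)$ be the Dyck path obtained by deleting all $H$'s. Its bounce path starts at $(n,n)$ and repeatedly goes west until it meets the end (top) of a $U$ step of $C(p)$, and then down to the diagonal, until it reaches $(0,0)$; $\mathrm{bounce}(C(p))$ is the sum of the $x$-coordinates of the points where it meets the diagonal, the initial point excluded. The $U$ steps of $C(p)$ at whose tops the bounce path turns south correspond to $U$ steps of $p$, called the peaks of $p$. For an $H$ step $\alpha$ of $p$ let $b(\alpha)$ be the number of peaks above it. The Egge--Haglund--Killpatrick--Kremer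 bounce is $\mathrm{bounce}^{\mathsf{Sch}}(p)=\mathrm{bounce}(C(p))+\sum_\alpha b(\alpha)$, the sum being over all $H$ steps of $p$. Theorem. The map $\phi$ is a bijection from $\mathrm{Schr}_{n,d}$ to the set of sorted recurrent configurations on $S_{n,d}$. If $c$ is a sorted recurrent configuration on $S_{n,d}$ and $w=\mu(\phi^{-1}(c))$, then $w\in\mathrm{Schr}_{n,d}$, $$\mathrm{area}(w)=\mathrm{level}(c)\quad\text{and}\quad \mathrm{bounce}^{\mathsf{Sch}}(w)=\mathrm{wtopple}_{ITC}(c)-(n+d).$$ -/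

import Mathlib

namespace Sandpile

/-! ### The sandpile model on a finite graph

The vertex set is `Option α`; the sink is `none`, and `α` is the set of non-sink vertices. -/

section General

variable {α : Type} [Fintype α] [DecidableEq α]

/-- The vertex `v` has fewer grains than its degree. -/
def StableAt (G : SimpleGraph (Option α)) [DecidableRel G.Adj] (c : α → ℕ) (v : α) : Prop :=
  c v < G.degree (some v)

instance (G : SimpleGraph (Option α)) [DecidableRel G.Adj] (c : α → ℕ) :
    DecidablePred (StableAt G c) :=
  fun v => inferInstanceAs (Decidable (c v < G.degree (some v)))

/-- A configuration is stable if every non-sink vertex is stable. -/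
def IsStable (G : SimpleGraph (Option α)) [DecidableRel G.Adj] (c : α → ℕ) : Prop :=
  ∀ v, StableAt G c v

/-- Topple in parallel the vertices of `A`: each of them donates one grain to each of its
neighbours. It is only used when all vertices of `A` are unstable, so that the subtraction
is the true one. -/
def topple (G : SimpleGraph (Option α)) [DecidableRel G.Adj] (c : α → ℕ) (A : Finset α) :
    α → ℕ :=
  fun u => c u + (A.filter fun v => G.Adj (some v) (some u)).card
    - (if u ∈ A then G.degree (some u) else 0)

/-- Topple the sink: every neighbour of the sink receives one grain. -/
def toppleSink (G : SimpleGraph (Option α)) [DecidableRel G.Adj] (c : α → ℕ) : α → ℕ :=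
  fun u => c u + (if G.Adj none (some u) then 1 else 0)

/-- One move of the sandpile model: add a grain at some vertex, or topple an unstable vertex. -/
inductive Move (G : SimpleGraph (Option α)) [DecidableRel G.Adj] : (α → ℕ) → (α → ℕ) → Prop
  | add (c : α → ℕ) (v : α) : Move G c (c + Pi.single v 1)
  | fire (c : α → ℕ) (v : α) (hv : ¬ StableAt G c v) : Move G c (topple G c {v})

/-- A stable configuration is recurrent if, whatever the current configuration, it can
always be reached (again) by adding grains and toppling unstable vertices. -/
def IsRecurrent (G : SimpleGraph (Option α)) [DecidableRel G.Adj] (c : α → ℕ) : Prop :=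
  IsStable G c ∧ ∀ c₀ : α → ℕ, Relation.ReflTransGen (Move G) c₀ c

end General

/-! ### The complete split graph -/

/-- The independent vertices are those of the form `some (Sum.inr i)`. -/
def isIndep {n d : ℕ} : Option (Fin n ⊕ Fin d) → Bool
  | some (Sum.inr _) => true
  | _ => false

/-- The complete split graph `S_{n,d}`: the clique part consists of the sink `none` and the
vertices `some (Sum.inl j)`; any two distinct vertices are adjacent, unless both are
independent. -/
def splitGraph (n d : ℕ) : SimpleGraph (Option (Fin n ⊕ Fin d)) where
  Adj x y := x ≠ y ∧ ¬ (isIndep x = true ∧ isIndep y = true)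
  symm := ⟨fun _ _ h => ⟨h.1.symm, fun h' => h.2 ⟨h'.2, h'.1⟩⟩⟩
  loopless := ⟨fun _ h => h.1 rfl⟩

instance (n d : ℕ) : DecidableRel (splitGraph n d).Adj :=
  fun x y => inferInstanceAs (Decidable (x ≠ y ∧ ¬ (isIndep x = true ∧ isIndep y = true)))

/-- A configuration `(a_1, …, a_n; b_1, …, b_d)` on `S_{n,d}`: the entries `a_j` are the
values at `Sum.inl`, the entries `b_i` are the values at `Sum.inr`. -/
abbrev Config (n d : ℕ) : Type := Fin n ⊕ Fin d → ℕ

/-- Sorted recurrent configurations: recurrent, `a_1 ≥ … ≥ a_n` and `b_1 ≥ … ≥ b_d`. -/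
def SortedRec (n d : ℕ) : Set (Config n d) :=
  {c | IsRecurrent (splitGraph n d) c ∧
    Antitone (fun j : Fin n => c (Sum.inl j)) ∧ Antitone (fun i : Fin d => c (Sum.inr i))}

/-- The sum of all entries. -/
def height {n d : ℕ} (c : Config n d) : ℕ := ∑ v, c v

/-- The height less the number of edges not incident to the sink. -/
def level {n d : ℕ} (c : Config n d) : ℤ :=
  (height c : ℤ) - (((n + d).choose 2 : ℤ) - (d.choose 2 : ℤ))

/-! ### ITC toppling -/

/-- The unstable independent vertices. -/
def unstableIndep {n d : ℕ} (c : Config n d) : Finset (Fin n ⊕ Fin d) :=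
  Finset.univ.filter fun v => v.isRight = true ∧ ¬ StableAt (splitGraph n d) c v

/-- The unstable (non-sink) clique vertices. -/
def unstableClique {n d : ℕ} (c : Config n d) : Finset (Fin n ⊕ Fin d) :=
  Finset.univ.filter fun v => v.isLeft = true ∧ ¬ StableAt (splitGraph n d) c v

/-- Topple in parallel the unstable independent vertices. -/
def toppleIndep {n d : ℕ} (c : Config n d) : Config n d :=
  topple (splitGraph n d) c (unstableIndep c)

/-- Topple in parallel the unstable clique vertices. -/
def toppleClique {n d : ℕ} (c : Config n d) : Config n d :=
  topple (splitGraph n d) c (unstableClique c)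

/-- The configuration after toppling the sink and then performing `k` loops
"independent, then clique". -/
def itcState {n d : ℕ} (c : Config n d) (k : ℕ) : Config n d :=
  (fun e => toppleClique (toppleIndep e))^[k] (toppleSink (splitGraph n d) c)

/-- The set `Q'_{k+1}` of independent vertices toppled in loop `k + 1`. -/
def itcQ {n d : ℕ} (c : Config n d) (k : ℕ) : Finset (Fin n ⊕ Fin d) :=
  unstableIndep (itcState c k)

/-- The set `P'_{k+1}` of clique vertices toppled in loop `k + 1`. -/
def itcP {n d : ℕ} (c : Config n d) (k : ℕ) : Finset (Fin n ⊕ Fin d) :=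
  unstableClique (toppleIndep (itcState c k))

/-- The number `t` of loops performed until no unstable vertex remains. -/
noncomputable def itcLength {n d : ℕ} (c : Config n d) : ℕ :=
  sInf {k | IsStable (splitGraph n d) (itcState c k)}

/-- `wtopple_ITC(c) = 1 (q'_1 + p'_1) + 2 (q'_2 + p'_2) + … + t (q'_t + p'_t)`. -/
noncomputable def wtoppleITC {n d : ℕ} (c : Config n d) : ℕ :=
  ∑ k ∈ Finset.range (itcLength c), (k + 1) * ((itcQ c k).card + (itcP c k).card)

/-! ### Schröder words and paths -/

/-- The letters: `U = (0,1)`, `H = (1,1)`, `D = (1,0)` as steps of a path. -/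
inductive Letter
  | U
  | H
  | D
  deriving DecidableEq

/-- Schröder words with `n` letters `U`, `n` letters `D` and `d` letters `H`. -/
def Schroder (n d : ℕ) : Set (List Letter) :=
  {p | p.count Letter.U = n ∧ p.count Letter.D = n ∧ p.count Letter.H = d ∧
    ∀ q : List Letter, q <+: p → q.count Letter.D ≤ q.count Letter.U}

/-- For each occurrence of the letter `s`, from left to right, the number of letters
satisfying `P` that follow this occurrence. -/
def followCounts (s : Letter) (P : Letter → Bool) : List Letter → List ℕ
  | [] => []
  | x :: p => if x = s then p.countP P :: followCounts s P p else followCounts s P p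

/-- The map from words to configurations: `a_j + 1` is the number of non-`U`'s following the
`j`th `U`, and `b_i` is the number of `D`'s following the `i`th `H`. (In a Schröder word
every `U` is followed by some non-`U`.) -/
def phi (n d : ℕ) (p : List Letter) : Config n d :=
  Sum.elim
    (fun j => (followCounts Letter.U (fun x => decide (x ≠ Letter.U)) p).getD j 0 - 1)
    (fun i => (followCounts Letter.H (fun x => decide (x = Letter.D)) p).getD i 0)

/-- The inverse of `phi` on Schröder words. -/
noncomputable def phiInv (n d : ℕ) (c : Config n d) : List Letter :=
  Function.invFunOn (phi n d) (Schroder n d) c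

/-- The mirror map on letters. -/
def mirrorLetter : Letter → Letter
  | Letter.U => Letter.D
  | Letter.H => Letter.H
  | Letter.D => Letter.U

/-- The mirror map on words: `μ(w_1 ⋯ w_k) = μ(w_k) ⋯ μ(w_1)`. -/
def mirror (p : List Letter) : List Letter := p.reverse.map mirrorLetter

/-- Abscissa of the end point of the path `q` started at the origin. -/
def xEnd (q : List Letter) : ℕ := q.count Letter.H + q.count Letter.D

/-- Ordinate of the end point of the path `q` started at the origin. -/
def yEnd (q : List Letter) : ℕ := q.count Letter.U + q.count Letter.H

/-- The lower triangle with vertices `(i,j)`, `(i+1,j)`, `(i+1,j+1)` lies between the path `p`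
and the diagonal `y = x`. It lies above the diagonal iff `i + 1 ≤ j`. It lies below the path
iff it lies below the step of `p` (with index `k`) that crosses the column `i ≤ x ≤ i+1`:
for a step `D` from `(i,h)` to `(i+1,h)` this means `j + 1 ≤ h`, and for a step `H` from
`(i,h)` to `(i+1,h+1)` it means `j ≤ h`. -/
def IsLowerTriangle (p : List Letter) (i j : ℕ) : Prop :=
  i + 1 ≤ j ∧ ∃ k < p.length, xEnd (p.take k) = i ∧
    ((p[k]? = some Letter.D ∧ j + 1 ≤ yEnd (p.take k)) ∨
      (p[k]? = some Letter.H ∧ j ≤ yEnd (p.take k)))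

instance (p : List Letter) (i j : ℕ) : Decidable (IsLowerTriangle p i j) :=
  inferInstanceAs (Decidable (_ ∧ _))

/-- The number of lower triangles between the path and the diagonal. (Coordinates of points of
the path are at most `p.length`, so that the range is no restriction.) -/
def area (p : List Letter) : ℕ :=
  ((Finset.range (p.length + 1) ×ˢ Finset.range (p.length + 1)).filter
    fun ij => IsLowerTriangle p ij.1 ij.2).card

/-- The word `C(p)` obtained by removing all letters `H`. -/
def collapse (p : List Letter) : List Letter := p.filter fun x => decide (x ≠ Letter.H)

/-- The number of `D`'s before the `m`th `U`: moving west along `y = m` one hits the boundary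
of the Dyck path in the point with this abscissa, the top of the `m`th `U` step. -/
def westEnd : List Letter → ℕ → ℕ
  | [], _ => 0
  | _ :: _, 0 => 0
  | Letter.U :: q, m + 1 => westEnd q m
  | Letter.H :: q, m + 1 => westEnd q (m + 1)
  | Letter.D :: q, m + 1 => westEnd q (m + 1) + 1

/-- The bounce path of the Dyck path `q` starts on the diagonal at `(a,a)`, where `a` is the
number of `U`'s. From `(m,m)` it moves west to the boundary point `(westEnd q m, m)`, then down
to the diagonal point `(westEnd q m, westEnd q m)`, and so on. `diagPoint q i` is the abscissa
of the `i`th diagonal point; it is `0` from some `i ≤ a` on. -/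
def diagPoint (q : List Letter) (i : ℕ) : ℕ := (westEnd q)^[i] (q.count Letter.U)

/-- The bounce of a Dyck path: the sum of the abscissas of the points where the bounce path
meets the diagonal, without the initial point. -/
def dyckBounce (q : List Letter) : ℕ :=
  ∑ i ∈ Finset.range (q.count Letter.U), diagPoint q (i + 1)

/-- The heights of the peaks of the bounce path of the Dyck path `q`: the bounce path has a
peak at height `m` for each diagonal point `(m,m)` with `m > 0`. -/
def peakHeights (q : List Letter) : Finset ℕ :=
  ((Finset.range (q.count Letter.U)).image (diagPoint q)).filter fun m => 0 < m

/-- The peaks of `p`, given by the indices of the corresponding letters `U` of `p`: the `m`th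
letter `U` is a peak iff the bounce path of `C(p)` has a peak at height `m`. -/
def peaks (p : List Letter) : Finset ℕ :=
  (Finset.range p.length).filter fun l =>
    p[l]? = some Letter.U ∧ (p.take (l + 1)).count Letter.U ∈ peakHeights (collapse p)

/-- The number of peaks (tops of peak steps) above the step with index `k`. -/
def peaksAbove (p : List Letter) (k : ℕ) : ℕ :=
  ((peaks p).filter fun l => yEnd (p.take (k + 1)) < yEnd (p.take (l + 1))).card

/-- The bounce of a Schröder path. -/
def bounceSch (p : List Letter) : ℕ :=
  dyckBounce (collapse p) +
    ∑ k ∈ (Finset.range p.length).filter (fun k => p[k]? = some Letter.H), peaksAbove p k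

end Sandpile

/-! Bijection. By Dhar's criterion (`isRecurrent_iff`) a stable configuration is recurrent iff no
nonempty set of non-sink vertices is forbidden. For a sorted configuration on the split graph it
suffices to test the sets formed by the last `i` clique and the last `r` independent vertices
(`unforbidden_iff`). Read on a word with the corresponding follow counts, these inequalities say
that every suffix has at least as many `D`'s as `U`'s (`SuffixDominated.countsCondition` and its
converse), which is the Schröder condition. A word can be recovered greedily from its follow counts
and its number of `D`'s (`eq_of_counts_eq`, `exists_word`), so `phi` is bijective.

Bounce. Let `p` be the word of `c`. Once `P` clique vertices have toppled, the next loop raises the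
number of toppled independent vertices to the number of `H`'s before the `(P+1)`st `D` of `p`, and
the number of toppled clique vertices to the number of `U`'s before that same `D` (`itcState_phi`).
For `P < n` the mirror image turns this `D` into the `U` at height `n - P` of the collapsed path.
Hence one step of the bounce path is one loop: the diagonal points are `n` minus the clique vertices
toppled so far, and the `H`'s before the corresponding peak are the independent vertices still
untoppled after the next independent phase. Summation by parts (`sum_mul_sub_eq`) converts the
weights in `wtoppleITC` into sums of untoppled vertices, with the extra term `n + d`.

Area. Prepending a letter to `p` appends a step to the mirrored path, which adds at most one column
of triangles; an induction compares these columns with the follow counts (`two_mul_area_mirror`). -/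

namespace Sandpile

/-! ### Dhar's burning criterion for recurrence -/

section General

variable {α : Type}

/-- The number of neighbours of `v` in the set `F` of non-sink vertices. -/
def degIn (G : SimpleGraph (Option α)) [DecidableRel G.Adj] (F : Finset α) (v : α) : ℕ :=
  (F.filter fun u => G.Adj (some u) (some v)).card

/-- No nonempty set `F` of non-sink vertices is a forbidden subconfiguration. -/
def Unforbidden (G : SimpleGraph (Option α)) [DecidableRel G.Adj] (c : α → ℕ) : Prop :=
  ∀ F : Finset α, F.Nonempty → ∃ v ∈ F, degIn G F v ≤ c v

variable (G : SimpleGraph (Option α)) [DecidableRel G.Adj]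

theorem degree_some_eq [Fintype α] (hs : ∀ v, G.Adj none (some v)) (v : α) :
    G.degree (some v) = degIn G Finset.univ v + 1 := by
  have h : G.neighborFinset (some v) =
      Finset.insertNone (Finset.univ.filter fun u => G.Adj (some u) (some v)) := by
    ext x
    cases x with
    | none => simp [(hs v).symm]
    | some u => simp [G.adj_comm]
  rw [← SimpleGraph.card_neighborFinset_eq_degree, h, Finset.card_insertNone, degIn]

theorem degIn_insert [DecidableEq α] (F : Finset α) (u v : α) (hv : v ∉ F) :
    degIn G (insert v F) u = degIn G F u + if G.Adj (some v) (some u) then 1 else 0 := by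
  unfold degIn
  rw [Finset.filter_insert]
  split_ifs with h
  · rw [Finset.card_insert_of_notMem (by simp [hv])]
  · rfl

theorem degIn_mono {E F : Finset α} (h : E ⊆ F) (v : α) : degIn G E v ≤ degIn G F v :=
  Finset.card_le_card (Finset.filter_subset_filter _ h)

variable [Fintype α] [DecidableEq α]

theorem topple_singleton (c : α → ℕ) (v u : α) :
    topple G c {v} u = c u + (if G.Adj (some v) (some u) then 1 else 0)
      - (if u = v then G.degree (some u) else 0) := by
  unfold topple
  rw [Finset.filter_singleton]
  split_ifs <;> simp_all

/-- When `v ∈ F` fires, apply the hypothesis to `F` without `v`: a vertex found there gains a grain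
exactly when putting `v` back raises its degree inside the set. If `F = {v}`, this degree is zero.
If `v ∉ F`, the vertices of `F` can only gain grains. -/
theorem Unforbidden.move {c c' : α → ℕ} (h : Unforbidden G c) (hm : Move G c c') :
    Unforbidden G c' := by
  intro F hF
  cases hm with
  | add v =>
    obtain ⟨u, hu, hle⟩ := h F hF
    exact ⟨u, hu, hle.trans (by simp)⟩
  | fire v hv =>
    by_cases hvF : v ∈ F
    · rcases (F.erase v).eq_empty_or_nonempty with he | he
      · refine ⟨v, hvF, ?_⟩
        have hFv : F = {v} := by
          rw [← Finset.insert_erase hvF, he]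
          rfl
        simp [degIn, hFv, Finset.filter_singleton]
      · obtain ⟨u, hu, hle⟩ := h _ he
        refine ⟨u, Finset.mem_of_mem_erase hu, ?_⟩
        have h1 := degIn_insert G (F.erase v) u v (by simp)
        rw [Finset.insert_erase hvF] at h1
        rw [topple_singleton, if_neg (Finset.ne_of_mem_erase hu)]
        omega
    · obtain ⟨u, hu, hle⟩ := h F hF
      refine ⟨u, hu, ?_⟩
      have huv : u ≠ v := by
        rintro rfl
        exact hvF hu
      rw [topple_singleton, if_neg huv]
      omega

theorem reflTransGen_move_add (e c : α → ℕ) : Relation.ReflTransGen (Move G) c (c + e) := by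
  induction hN : ∑ v, e v generalizing e with
  | zero =>
    have : e = 0 := by
      funext v
      simpa using (Finset.sum_eq_zero_iff.1 hN) v (Finset.mem_univ v)
    simpa [this] using Relation.ReflTransGen.refl
  | succ N ih =>
    obtain ⟨v, -, hv⟩ : ∃ v ∈ Finset.univ, e v ≠ 0 := by
      by_contra! hcon
      rw [Finset.sum_eq_zero hcon] at hN
      omega
    have he : e = (e - Pi.single v 1) + Pi.single v 1 := by
      funext u
      by_cases hu : u = v
      · subst hu
        simp
        omega
      · simp [hu]
    have hs : ∑ u, (e - Pi.single v 1 : α → ℕ) u = N := by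
      have := congrArg (fun f : α → ℕ => ∑ u, f u) he
      simp only [Pi.add_apply, Finset.sum_add_distrib] at this
      rw [hN, Finset.sum_pi_single'] at this
      simp at this ⊢
      omega
    rw [he, ← add_assoc]
    exact (ih _ hs).tail (Move.add _ v)

/-- Burning algorithm. The source is `c + (k + 1)` after each vertex of the burnt set `A` has fired
once, and `hA` makes the truncated subtraction a true one. When `A` is everything, each vertex has
lost its degree and regained all of it but the grain sent to the sink, which leaves `c + k`. The
case `A = ∅` therefore lowers every entry by one. -/
theorem reflTransGen_move_burn (hs : ∀ v, G.Adj none (some v)) {c : α → ℕ}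
    (hc : Unforbidden G c) (k : ℕ) (A : Finset α)
    (hA : ∀ u ∈ A, G.degree (some u) ≤ c u + 1 + degIn G A u) :
    Relation.ReflTransGen (Move G)
      (fun u => c u + (k + 1) + degIn G A u - if u ∈ A then G.degree (some u) else 0)
      (fun u => c u + k) := by
  induction hN : Aᶜ.card generalizing A with
  | zero =>
    have hA' : A = Finset.univ := by simpa using hN
    subst hA'
    convert Relation.ReflTransGen.refl using 1
    funext u
    rw [if_pos (Finset.mem_univ u), degree_some_eq G hs]
    omega
  | succ N ih =>
    -- Some unburnt `v` has at least as many grains as unburnt neighbours; the grains from `A` and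
    -- one of the `k + 1` extra grains bring it up to its degree.
    obtain ⟨v, hv, hle⟩ := hc Aᶜ (Finset.card_pos.1 (by omega))
    have hvA : v ∉ A := by simpa using hv
    have hsplit : degIn G Finset.univ v = degIn G A v + degIn G Aᶜ v := by
      unfold degIn
      rw [← Finset.card_union_of_disjoint
        (Finset.disjoint_filter_filter disjoint_compl_right), ← Finset.filter_union,
        Finset.union_compl]
    have hdeg := degree_some_eq G hs v
    refine Relation.ReflTransGen.head (Move.fire _ v ?_) ?_
    · unfold StableAt
      simp only [hvA, if_false]
      omega
    · have key := ih (insert v A) ?_ ?_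
      · convert key using 1
        funext u
        rw [topple_singleton, degIn_insert G A u v hvA]
        by_cases huv : u = v
        · subst huv
          simp [hvA]
        · by_cases hu : u ∈ A
          · have := hA u hu
            simp only [hu, huv, if_true, if_false, Finset.mem_insert, or_true]
            omega
          · simp only [hu, huv, if_false, Finset.mem_insert, or_self]
            omega
      · intro u hu
        rcases Finset.mem_insert.1 hu with rfl | hu
        · rw [degIn_insert G A u u hvA]
          omega
        · rw [degIn_insert G A u v hvA]
          have := hA u hu
          omega
      · rw [Finset.compl_insert, Finset.card_erase_of_mem hv, hN]
        rfl

/-- Dhar's criterion, for a graph in which every vertex is a neighbour of the sink. -/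
theorem isRecurrent_iff (hs : ∀ v, G.Adj none (some v)) (c : α → ℕ) :
    IsRecurrent G c ↔ IsStable G c ∧ Unforbidden G c := by
  refine and_congr_right fun _ => ⟨fun h => ?_, fun h c₀ => ?_⟩
  -- It is enough to reach `c` from one configuration without forbidden sets, since moves preserve
  -- this property.
  · have h0 : Unforbidden G (fun v => G.degree (some v)) := by
      rintro F ⟨v, hv⟩
      refine ⟨v, hv, ?_⟩
      have h1 := degIn_mono G (Finset.subset_univ F) v
      have h2 := degree_some_eq G hs v
      change degIn G F v ≤ G.degree (some v)
      omega
    have hr := h (fun v => G.degree (some v))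
    exact hr.head_induction_on (motive := fun a _ => Unforbidden G a → Unforbidden G c) id
      (fun hm _ ih ha => ih (ha.move G hm)) h0
  · have hk : ∀ k : ℕ, Relation.ReflTransGen (Move G) (fun u => c u + k) c := by
      intro k
      induction k with
      | zero => exact Relation.ReflTransGen.refl
      | succ k ih =>
        refine Relation.ReflTransGen.trans ?_ ih
        have := reflTransGen_move_burn G hs h k ∅ (by simp)
        simpa [degIn] using this
    have hle : ∀ u, c₀ u ≤ ∑ v, c₀ v := fun u =>
      Finset.single_le_sum (f := c₀) (fun _ _ => Nat.zero_le _) (Finset.mem_univ u)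
    -- Every entry of `c₀` is at most the total of `c₀`, so adding grains leads to `c` plus that
    -- constant; burning then removes the constant one unit at a time.
    have h1 := reflTransGen_move_add G (fun u => c u + ∑ v, c₀ v - c₀ u) c₀
    have h2 : (c₀ + fun u => c u + ∑ v, c₀ v - c₀ u) = fun u => c u + ∑ v, c₀ v := by
      funext u
      have := hle u
      simp only [Pi.add_apply]
      omega
    rw [h2] at h1
    exact h1.trans (hk _)

end General

/-! ### Reconstructing a word from its follow counts -/

/-- The numbers of letters other than `U` following the letters `U`. -/
def uCounts (p : List Letter) : List ℕ :=
  followCounts Letter.U (fun x => decide (x ≠ Letter.U)) p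

/-- The numbers of letters `D` following the letters `H`. -/
def hCounts (p : List Letter) : List ℕ :=
  followCounts Letter.H (fun x => decide (x = Letter.D)) p

theorem countP_ne_U (p : List Letter) :
    p.countP (fun x => decide (x ≠ Letter.U)) = p.count Letter.H + p.count Letter.D := by
  induction p with
  | nil => rfl
  | cons x p ih => cases x <;> simp_all <;> omega

theorem countP_eq_D (p : List Letter) :
    p.countP (fun x => decide (x = Letter.D)) = p.count Letter.D := by
  rw [List.count]
  congr 1

@[simp] theorem uCounts_nil : uCounts [] = [] := rfl
@[simp] theorem hCounts_nil : hCounts [] = [] := rfl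

@[simp] theorem uCounts_U (p : List Letter) :
    uCounts (Letter.U :: p) = (p.count Letter.H + p.count Letter.D) :: uCounts p := by
  simp only [uCounts, followCounts, if_true, countP_ne_U]

@[simp] theorem uCounts_H (p : List Letter) : uCounts (Letter.H :: p) = uCounts p := by
  simp [uCounts, followCounts]

@[simp] theorem uCounts_D (p : List Letter) : uCounts (Letter.D :: p) = uCounts p := by
  simp [uCounts, followCounts]

@[simp] theorem hCounts_U (p : List Letter) : hCounts (Letter.U :: p) = hCounts p := by
  simp [hCounts, followCounts]

@[simp] theorem hCounts_H (p : List Letter) :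
    hCounts (Letter.H :: p) = p.count Letter.D :: hCounts p := by
  simp only [hCounts, followCounts, if_true, countP_eq_D]

@[simp] theorem hCounts_D (p : List Letter) : hCounts (Letter.D :: p) = hCounts p := by
  simp [hCounts, followCounts]

theorem length_uCounts (p : List Letter) : (uCounts p).length = p.count Letter.U := by
  induction p with
  | nil => rfl
  | cons x p ih => cases x <;> simp [ih]

theorem length_hCounts (p : List Letter) : (hCounts p).length = p.count Letter.H := by
  induction p with
  | nil => rfl
  | cons x p ih => cases x <;> simp [ih]

theorem le_of_mem_uCounts (p : List Letter) :
    ∀ a ∈ uCounts p, a ≤ p.count Letter.H + p.count Letter.D := by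
  induction p with
  | nil => simp
  | cons x p ih =>
    intro a ha
    cases x
    · rw [uCounts_U, List.mem_cons] at ha
      rcases ha with rfl | ha
      · simp
      · simpa [List.count_cons] using ih a ha
    all_goals
      have := ih a (by simpa using ha)
      simp
      omega

theorem le_of_mem_hCounts (p : List Letter) : ∀ b ∈ hCounts p, b ≤ p.count Letter.D := by
  induction p with
  | nil => simp
  | cons x p ih =>
    intro a ha
    cases x
    · simpa [List.count_cons] using ih a (by simpa using ha)
    · rw [hCounts_H, List.mem_cons] at ha
      rcases ha with rfl | ha
      · simp
      · simpa [List.count_cons] using ih a ha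
    · have := ih a (by simpa using ha)
      simp
      omega

theorem pairwise_uCounts (p : List Letter) : (uCounts p).Pairwise (· ≥ ·) := by
  induction p with
  | nil => simp
  | cons x p ih =>
    cases x
    · rw [uCounts_U, List.pairwise_cons]
      exact ⟨le_of_mem_uCounts p, ih⟩
    all_goals simpa using ih

theorem pairwise_hCounts (p : List Letter) : (hCounts p).Pairwise (· ≥ ·) := by
  induction p with
  | nil => simp
  | cons x p ih =>
    cases x
    · simpa using ih
    · rw [hCounts_H, List.pairwise_cons]
      exact ⟨le_of_mem_hCounts p, ih⟩
    · simpa using ih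

/-- The first letter is determined: it is `U` iff the head of `uCounts` equals the total number of
`H`'s and `D`'s; failing that, it is `H` iff the head of `hCounts` equals the total number of `D`'s;
otherwise it is `D`. The bounds on the entries exclude every mismatch. -/
theorem eq_of_counts_eq {p q : List Letter} (hU : uCounts p = uCounts q)
    (hH : hCounts p = hCounts q) (hD : p.count Letter.D = q.count Letter.D) : p = q := by
  have lU := congrArg List.length hU
  have lH := congrArg List.length hH
  rw [length_uCounts, length_uCounts] at lU
  rw [length_hCounts, length_hCounts] at lH
  induction p generalizing q with
  | nil =>
    cases q with
    | nil => rfl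
    | cons y q => cases y <;> simp at lU lH hD
  | cons x p ih =>
    cases q with
    | nil => cases x <;> simp at lU lH hD
    | cons y q =>
      cases x <;> cases y <;> simp at lU lH hD hU hH
      · rw [ih hU.2 hH hD lU lH]
      · have := le_of_mem_uCounts q _ (hU ▸ List.mem_cons_self)
        omega
      · have := le_of_mem_uCounts q _ (hU ▸ List.mem_cons_self)
        omega
      · have := le_of_mem_uCounts p _ (hU ▸ List.mem_cons_self)
        omega
      · rw [ih hU hH.2 hD lU lH]
      · have := le_of_mem_hCounts q _ (hH ▸ List.mem_cons_self)
        omega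
      · have := le_of_mem_uCounts p _ (hU ▸ List.mem_cons_self)
        omega
      · have := le_of_mem_hCounts p _ (hH ▸ List.mem_cons_self)
        omega
      · rw [ih hU hH hD lU lH]

/-- The word is built greedily from the left by the rule that determines the first letter: `U` if
`A` starts with its maximal allowed value, else `H` if `B` does, else `D`. When a test fails,
monotonicity makes all entries strictly smaller than the bound, so the bounds survive the removal of
a letter. -/
theorem exists_word (A B : List ℕ) (m : ℕ) (hA : A.Pairwise (· ≥ ·)) (hB : B.Pairwise (· ≥ ·))
    (hA' : ∀ a ∈ A, a ≤ B.length + m) (hB' : ∀ b ∈ B, b ≤ m) :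
    ∃ p, uCounts p = A ∧ hCounts p = B ∧ p.count Letter.D = m := by
  induction hN : A.length + B.length + m generalizing A B m with
  | zero =>
    obtain rfl : A = [] := List.length_eq_zero_iff.1 (by omega)
    obtain rfl : B = [] := List.length_eq_zero_iff.1 (by omega)
    exact ⟨[], rfl, rfl, by simp; omega⟩
  | succ N ih =>
    by_cases hU : ∃ A', A = (B.length + m) :: A'
    · obtain ⟨A', rfl⟩ := hU
      obtain ⟨p, h1, h2, h3⟩ := ih A' B m (List.pairwise_cons.1 hA).2 hB
        (fun a ha => hA' a (List.mem_cons_of_mem _ ha)) hB' (by simp at hN; omega)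
      refine ⟨Letter.U :: p, ?_, by simpa using h2, by simpa [List.count_cons] using h3⟩
      rw [uCounts_U, h1, ← length_hCounts, h2, h3]
    have hlt : ∀ a ∈ A, a < B.length + m := by
      intro a ha
      cases A with
      | nil => simp at ha
      | cons x A =>
        have h1 := hA' x List.mem_cons_self
        have h2 : x ≠ B.length + m := fun e => hU ⟨A, by rw [e]⟩
        rcases List.mem_cons.1 ha with rfl | ha
        · omega
        · have := (List.pairwise_cons.1 hA).1 a ha
          omega
    by_cases hH : ∃ B', B = m :: B'
    · obtain ⟨B', rfl⟩ := hH
      obtain ⟨p, h1, h2, h3⟩ := ih A B' m hA (List.pairwise_cons.1 hB).2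
        (fun a ha => by have := hlt a ha; simp at this; omega)
        (fun b hb => hB' b (List.mem_cons_of_mem _ hb)) (by simp at hN; omega)
      refine ⟨Letter.H :: p, by simpa using h1, ?_, by simpa [List.count_cons] using h3⟩
      rw [hCounts_H, h2, h3]
    have hlt' : ∀ b ∈ B, b < m := by
      intro b hb
      cases B with
      | nil => simp at hb
      | cons x B =>
        have h1 := hB' x List.mem_cons_self
        have h2 : x ≠ m := fun e => hH ⟨B, by rw [e]⟩
        rcases List.mem_cons.1 hb with rfl | hb
        · omega
        · have := (List.pairwise_cons.1 hB).1 b hb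
          omega
    -- With no `D` left the strict bounds would empty `B` and then `A`, although letters remain to
    -- be placed.
    have hm : 0 < m := by
      by_contra hm
      obtain rfl : m = 0 := by omega
      have hB0 : B = [] := List.eq_nil_iff_forall_not_mem.2 fun b hb => by
        have := hlt' b hb
        omega
      subst hB0
      have hA0 : A = [] := List.eq_nil_iff_forall_not_mem.2 fun a ha => by
        have := hlt a ha
        simp at this
      subst hA0
      simp at hN
    obtain ⟨p, h1, h2, h3⟩ := ih A B (m - 1) hA hB
      (fun a ha => by have := hlt a ha; omega) (fun b hb => by have := hlt' b hb; omega) (by omega)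
    refine ⟨Letter.D :: p, by simpa using h1, by simpa using h2, ?_⟩
    simp
    omega

/-! ### The ballot condition in terms of follow counts -/

/-- Every suffix of the word has at least as many letters `D` as letters `U`. -/
def SuffixDominated (p : List Letter) : Prop :=
  ∀ s : List Letter, s <:+ p → s.count Letter.U ≤ s.count Letter.D

theorem SuffixDominated.of_cons {x : Letter} {p : List Letter} (h : SuffixDominated (x :: p)) :
    SuffixDominated p := fun s hs => h s (hs.trans (List.suffix_cons x p))

theorem SuffixDominated.count_le {p : List Letter} (h : SuffixDominated p) :
    p.count Letter.U ≤ p.count Letter.D := h p List.suffix_rfl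

theorem mem_Schroder_iff {n d : ℕ} {p : List Letter} :
    p ∈ Schroder n d ↔ p.count Letter.U = n ∧ p.count Letter.D = n ∧ p.count Letter.H = d ∧
      SuffixDominated p := by
  refine and_congr_right fun hU => and_congr_right fun hD => and_congr_right fun _ =>
    ⟨fun h s hs => ?_, fun h q hq => ?_⟩
  · obtain ⟨q, rfl⟩ := hs
    have := h q (List.prefix_append _ _)
    simp only [List.count_append] at hU hD
    omega
  · obtain ⟨s, rfl⟩ := hq
    have := h s (List.suffix_append _ _)
    simp only [List.count_append] at hU hD
    omega

/-- A numerical form of the absence of forbidden subconfigurations. -/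
def CountsCondition (A B : List ℕ) : Prop :=
  ∀ i r, i ≤ A.length → r ≤ B.length → 0 < i + r →
    (0 < i ∧ i + r ≤ A.getD (A.length - i) 0) ∨ (0 < r ∧ i ≤ B.getD (B.length - r) 0)

/-- Cut `p` at the earlier of the `i`th `U` and the `r`th `H` from the end. If the cut is at the
`U`, at least `r` letters `H` and `i` letters `D` follow it; if it is at the `H`, at least `i`
letters `U`, hence as many `D`'s, follow it. The induction discards letters until the cut is
reached. -/
theorem SuffixDominated.countsCondition {p : List Letter} (h : SuffixDominated p) :
    CountsCondition (uCounts p) (hCounts p) := by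
  induction p with
  | nil =>
    intro i r hi hr h0
    simp at hi hr
    omega
  | cons x p ih =>
    have ih' := ih h.of_cons
    intro i r hi hr h0
    cases x
    · rw [uCounts_U, hCounts_U, List.length_cons] at *
      rcases hi.lt_or_eq with hi' | hi'
      · have e : (uCounts p).length + 1 - i = ((uCounts p).length - i) + 1 := by omega
        rw [e, List.getD_cons_succ]
        exact ih' i r (by omega) hr h0
      · left
        rw [hi', Nat.sub_self, List.getD_cons_zero]
        rw [length_uCounts] at hi' ⊢
        rw [length_hCounts] at hr
        have := h.count_le
        simp at this
        omega
    · rw [uCounts_H, hCounts_H, List.length_cons] at *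
      rcases hr.lt_or_eq with hr' | hr'
      · have e : (hCounts p).length + 1 - r = ((hCounts p).length - r) + 1 := by omega
        rw [e, List.getD_cons_succ]
        exact ih' i r hi (by omega) h0
      · right
        rw [hr', Nat.sub_self, List.getD_cons_zero]
        rw [length_uCounts] at hi
        have := h.of_cons.count_le
        omega
    · rw [uCounts_D, hCounts_D] at *
      exact ih' i r hi hr h0

theorem uCounts_append (l s : List Letter) : ∃ l', uCounts (l ++ s) = l' ++ uCounts s := by
  induction l with
  | nil => exact ⟨[], rfl⟩
  | cons x l ih =>
    obtain ⟨l', hl'⟩ := ih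
    cases x
    · exact ⟨_ :: l', by rw [List.cons_append, uCounts_U, hl', List.cons_append]⟩
    all_goals exact ⟨l', by simpa using hl'⟩

theorem hCounts_append (l s : List Letter) : ∃ l', hCounts (l ++ s) = l' ++ hCounts s := by
  induction l with
  | nil => exact ⟨[], rfl⟩
  | cons x l ih =>
    obtain ⟨l', hl'⟩ := ih
    cases x
    · exact ⟨l', by simpa using hl'⟩
    · exact ⟨_ :: l', by rw [List.cons_append, hCounts_H, hl', List.cons_append]⟩
    · exact ⟨l', by simpa using hl'⟩

theorem getD_mem_or_zero (l : List ℕ) (k : ℕ) : l.getD k 0 ∈ l ∨ l.getD k 0 = 0 := by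
  by_cases h : k < l.length
  · left
    rw [List.getD_eq_getElem _ _ h]
    exact List.getElem_mem h
  · right
    exact List.getD_eq_default _ _ (by omega)

/-- A suffix with more `U`'s than `D`'s violates the condition when `i` and `r` are its numbers of
`U`'s and `H`'s: its own letters leave too little room for either alternative. -/
theorem CountsCondition.suffixDominated {p : List Letter}
    (h : CountsCondition (uCounts p) (hCounts p)) : SuffixDominated p := by
  rintro s ⟨l, rfl⟩
  by_contra! hlt
  obtain ⟨l₁, h₁⟩ := uCounts_append l s
  obtain ⟨l₂, h₂⟩ := hCounts_append l s
  have hu := length_uCounts s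
  have hh := length_hCounts s
  rw [h₁, h₂] at h
  rcases h (s.count Letter.U) (s.count Letter.H) (by simp [hu]) (by simp [hh]) (by omega)
    with ⟨-, h⟩ | ⟨-, h⟩
  · rw [List.length_append, hu, Nat.add_sub_cancel, List.getD_append_right _ _ _ _ le_rfl] at h
    rcases getD_mem_or_zero (uCounts s) (l₁.length - l₁.length) with h' | h'
    · have := le_of_mem_uCounts s _ h'
      omega
    · omega
  · rw [List.length_append, hh, Nat.add_sub_cancel, List.getD_append_right _ _ _ _ le_rfl] at h
    rcases getD_mem_or_zero (hCounts s) (l₂.length - l₂.length) with h' | h'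
    · have := le_of_mem_hCounts s _ h'
      omega
    · omega

/-! ### Recurrent configurations on the split graph -/

section SplitGraph

variable {n d : ℕ}

theorem splitGraph_adj_none (v : Fin n ⊕ Fin d) : (splitGraph n d).Adj none (some v) :=
  ⟨by simp, by simp [isIndep]⟩

theorem splitGraph_adj_inl (u : Fin n ⊕ Fin d) (j : Fin n) :
    (splitGraph n d).Adj (some u) (some (Sum.inl j)) ↔ u ≠ Sum.inl j := by
  simp [splitGraph, isIndep]

theorem splitGraph_adj_inr (u : Fin n ⊕ Fin d) (i : Fin d) :
    (splitGraph n d).Adj (some u) (some (Sum.inr i)) ↔ u.isLeft = true := by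
  cases u <;> simp [splitGraph, isIndep]

theorem degIn_inl (F : Finset (Fin n ⊕ Fin d)) (j : Fin n) :
    degIn (splitGraph n d) F (Sum.inl j) = (F.erase (Sum.inl j)).card := by
  unfold degIn
  congr 1
  ext u
  simp [splitGraph_adj_inl, and_comm]

theorem degIn_inr (F : Finset (Fin n ⊕ Fin d)) (i : Fin d) :
    degIn (splitGraph n d) F (Sum.inr i) = F.toLeft.card := by
  unfold degIn
  rw [← Finset.card_map (Function.Embedding.inl : Fin n ↪ Fin n ⊕ Fin d)]
  congr 1
  ext u
  cases u <;> simp [splitGraph_adj_inr]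

theorem degree_inl (j : Fin n) : (splitGraph n d).degree (some (Sum.inl j)) = n + d := by
  rw [degree_some_eq _ splitGraph_adj_none, degIn_inl, Finset.card_erase_add_one (by simp)]
  simp

theorem degree_inr (i : Fin d) : (splitGraph n d).degree (some (Sum.inr i)) = n + 1 := by
  rw [degree_some_eq _ splitGraph_adj_none, degIn_inr]
  simp

theorem isStable_splitGraph_iff (c : Config n d) :
    IsStable (splitGraph n d) c ↔
      (∀ j, c (Sum.inl j) < n + d) ∧ ∀ i, c (Sum.inr i) < n + 1 := by
  simp only [IsStable, StableAt, Sum.forall, degree_inl, degree_inr]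

theorem card_le_sub_of_le {m : ℕ} {S : Finset (Fin m)} {k : Fin m} (h : ∀ x ∈ S, k ≤ x) :
    S.card ≤ m - k := by
  rw [← Fin.card_Ici]
  exact Finset.card_le_card fun x hx => Finset.mem_Ici.2 (h x hx)

theorem card_filter_le_val {m i : ℕ} (hi : i ≤ m) :
    (Finset.univ.filter fun x : Fin m => m - i ≤ x.val).card = i := by
  rcases Nat.eq_zero_or_pos i with rfl | h0
  · rw [Finset.card_eq_zero, Finset.filter_eq_empty_iff]
    intro x _
    have := x.isLt
    omega
  · have h : (Finset.univ.filter fun x : Fin m => m - i ≤ x.val) =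
        Finset.Ici (⟨m - i, by omega⟩ : Fin m) := by
      ext x
      simp [Fin.le_def]
    rw [h, Fin.card_Ici]
    simp
    omega

/-- Inside a set of `i` clique and `r` independent vertices, a clique vertex has `i + r - 1`
neighbours and an independent one has `i`. These depend only on `i` and `r`, so the critical set
consists of the last vertices of each kind, and its best candidates are the first of each block. -/
theorem unforbidden_iff {c : Config n d} (ha : Antitone fun j : Fin n => c (Sum.inl j))
    (hb : Antitone fun i : Fin d => c (Sum.inr i)) :
    Unforbidden (splitGraph n d) c ↔ ∀ i r, i ≤ n → r ≤ d → 0 < i + r →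
      (∃ j : Fin n, j.val + i = n ∧ i + r ≤ c (Sum.inl j) + 1) ∨
        ∃ k : Fin d, k.val + r = d ∧ i ≤ c (Sum.inr k) := by
  constructor
  · intro h i r hi hr h0
    set F : Finset (Fin n ⊕ Fin d) :=
      (Finset.univ.filter fun x : Fin n => n - i ≤ x.val).disjSum
        (Finset.univ.filter fun x : Fin d => d - r ≤ x.val) with hF
    have hcard : F.card = i + r := by
      rw [hF, Finset.card_disjSum, card_filter_le_val hi, card_filter_le_val hr]
    obtain ⟨v, hv, hle⟩ := h F (Finset.card_pos.1 (by omega))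
    cases v with
    | inl j =>
      have hj : n - i ≤ j.val := by simpa [hF] using hv
      rw [degIn_inl, Finset.card_erase_of_mem hv, hcard] at hle
      have hjn := j.isLt
      refine Or.inl ⟨⟨n - i, by omega⟩, by simp; omega, ?_⟩
      have : c (Sum.inl j) ≤ c (Sum.inl ⟨n - i, by omega⟩) := ha (Fin.le_def.2 hj)
      omega
    | inr k =>
      have hk : d - r ≤ k.val := by simpa [hF] using hv
      rw [degIn_inr, hF, Finset.toLeft_disjSum, card_filter_le_val hi] at hle
      have hkd := k.isLt
      refine Or.inr ⟨⟨d - r, by omega⟩, by simp; omega, ?_⟩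
      have : c (Sum.inr k) ≤ c (Sum.inr ⟨d - r, by omega⟩) := hb (Fin.le_def.2 hk)
      omega
  · intro h F hF
    have hcard : F.toLeft.card + F.toRight.card = F.card := Finset.card_toLeft_add_card_toRight
    have hl : F.toLeft.card ≤ n := by simpa using Finset.card_le_univ F.toLeft
    have hr : F.toRight.card ≤ d := by simpa using Finset.card_le_univ F.toRight
    have hpos : 0 < F.card := Finset.card_pos.2 hF
    rcases h _ _ hl hr (by omega) with ⟨j, hj, hle⟩ | ⟨k, hk, hle⟩
    · have hne : F.toLeft.Nonempty := Finset.card_pos.1 (by have := j.isLt; omega)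
      have hmem := Finset.min'_mem _ hne
      -- All clique vertices of `F` have index at least `j₀`, which forces `j₀ ≤ j`; sortedness then
      -- carries the bound from `j` to `j₀`.
      have hmin := card_le_sub_of_le (k := F.toLeft.min' hne) fun x hx => Finset.min'_le _ x hx
      set j₀ := F.toLeft.min' hne
      refine ⟨Sum.inl j₀, by simpa using hmem, ?_⟩
      have hjj : j₀ ≤ j := Fin.le_def.2 (by have := j₀.isLt; omega)
      have h1 : c (Sum.inl j) ≤ c (Sum.inl j₀) := ha hjj
      rw [degIn_inl, Finset.card_erase_of_mem (by simpa using hmem)]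
      omega
    · have hne : F.toRight.Nonempty := Finset.card_pos.1 (by have := k.isLt; omega)
      have hmem := Finset.min'_mem _ hne
      have hmin := card_le_sub_of_le (k := F.toRight.min' hne) fun x hx => Finset.min'_le _ x hx
      set k₀ := F.toRight.min' hne
      refine ⟨Sum.inr k₀, by simpa using hmem, ?_⟩
      have hkk : k₀ ≤ k := Fin.le_def.2 (by have := k₀.isLt; omega)
      have h1 : c (Sum.inr k) ≤ c (Sum.inr k₀) := hb hkk
      rw [degIn_inr]
      omega

theorem mem_SortedRec_iff {c : Config n d} :
    c ∈ SortedRec n d ↔ (∀ j, c (Sum.inl j) < n + d) ∧ (∀ i, c (Sum.inr i) < n + 1) ∧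
      CountsCondition (List.ofFn fun j => c (Sum.inl j) + 1) (List.ofFn fun i => c (Sum.inr i)) ∧
      Antitone (fun j : Fin n => c (Sum.inl j)) ∧ Antitone (fun i : Fin d => c (Sum.inr i)) := by
  unfold SortedRec
  rw [Set.mem_ofPred_eq, isRecurrent_iff _ splitGraph_adj_none, isStable_splitGraph_iff]
  have key : ∀ (ha : Antitone fun j : Fin n => c (Sum.inl j))
      (hb : Antitone fun i : Fin d => c (Sum.inr i)), Unforbidden (splitGraph n d) c ↔
      CountsCondition (List.ofFn fun j => c (Sum.inl j) + 1)
        (List.ofFn fun i => c (Sum.inr i)) := by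
    intro ha hb
    rw [unforbidden_iff ha hb]
    unfold CountsCondition
    simp only [List.length_ofFn]
    refine forall₅_congr fun i r hi hr h0 => or_congr ⟨?_, ?_⟩ ⟨?_, ?_⟩
    · rintro ⟨j, hj, hle⟩
      have hjn := j.isLt
      refine ⟨by omega, ?_⟩
      rw [List.getD_eq_getElem _ _ (by simp; omega), List.getElem_ofFn]
      have : (⟨n - i, by omega⟩ : Fin n) = j := Fin.ext (by simp; omega)
      rwa [this]
    · rintro ⟨hi0, hle⟩
      rw [List.getD_eq_getElem _ _ (by simp; omega), List.getElem_ofFn] at hle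
      exact ⟨⟨n - i, by omega⟩, by simp; omega, hle⟩
    · rintro ⟨j, hj, hle⟩
      have hjn := j.isLt
      refine ⟨by omega, ?_⟩
      rw [List.getD_eq_getElem _ _ (by simp; omega), List.getElem_ofFn]
      have : (⟨d - r, by omega⟩ : Fin d) = j := Fin.ext (by simp; omega)
      rwa [this]
    · rintro ⟨hi0, hle⟩
      rw [List.getD_eq_getElem _ _ (by simp; omega), List.getElem_ofFn] at hle
      exact ⟨⟨d - r, by omega⟩, by simp; omega, hle⟩
  constructor
  · rintro ⟨⟨⟨h1, h2⟩, h3⟩, ha, hb⟩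
    exact ⟨h1, h2, (key ha hb).1 h3, ha, hb⟩
  · rintro ⟨h1, h2, h3, ha, hb⟩
    exact ⟨⟨⟨h1, h2⟩, (key ha hb).2 h3⟩, ha, hb⟩

end SplitGraph

/-! ### The bijection -/

section Phi

variable {n d : ℕ}

/-- Ensures that the `- 1` in `phi` is never truncated. -/
theorem SuffixDominated.pos_of_mem_uCounts {p : List Letter} (h : SuffixDominated p) :
    ∀ a ∈ uCounts p, 0 < a := by
  induction p with
  | nil => simp
  | cons x p ih =>
    intro a ha
    cases x
    · rw [uCounts_U, List.mem_cons] at ha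
      rcases ha with rfl | ha
      · have := h.count_le
        simp at this
        omega
      · exact ih h.of_cons a ha
    all_goals exact ih h.of_cons a (by simpa using ha)

theorem phi_inl (p : List Letter) (j : Fin n) :
    phi n d p (Sum.inl j) = (uCounts p).getD j 0 - 1 := rfl

theorem phi_inr (p : List Letter) (i : Fin d) :
    phi n d p (Sum.inr i) = (hCounts p).getD i 0 := rfl

theorem ofFn_phi_inl {p : List Letter} (hp : p ∈ Schroder n d) :
    (List.ofFn fun j => phi n d p (Sum.inl j) + 1) = uCounts p := by
  obtain ⟨hU, -, -, hS⟩ := mem_Schroder_iff.1 hp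
  apply List.ext_getElem
  · simp [length_uCounts, hU]
  · intro k h1 h2
    rw [List.getElem_ofFn, phi_inl, List.getD_eq_getElem _ _ h2]
    have := hS.pos_of_mem_uCounts _ (List.getElem_mem h2)
    omega

theorem ofFn_phi_inr {p : List Letter} (hp : p ∈ Schroder n d) :
    (List.ofFn fun i => phi n d p (Sum.inr i)) = hCounts p := by
  obtain ⟨-, -, hH, -⟩ := mem_Schroder_iff.1 hp
  apply List.ext_getElem
  · simp [length_hCounts, hH]
  · intro k h1 h2
    rw [List.getElem_ofFn, phi_inr, List.getD_eq_getElem _ _ h2]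

theorem antitone_of_pairwise_ofFn {m : ℕ} {f : Fin m → ℕ}
    (h : (List.ofFn f).Pairwise (· ≥ ·)) : Antitone f := by
  rw [List.pairwise_ofFn] at h
  intro i j hij
  rcases hij.lt_or_eq with h' | rfl
  · exact h h'
  · exact le_rfl

theorem pairwise_ofFn_of_antitone {m : ℕ} {f : Fin m → ℕ} (h : Antitone f) :
    (List.ofFn f).Pairwise (· ≥ ·) := by
  rw [List.pairwise_ofFn]
  exact fun i j hij => h hij.le

theorem phi_injOn : Set.InjOn (phi n d) (Schroder n d) := by
  intro p hp q hq h
  refine eq_of_counts_eq ?_ ?_ ?_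
  · rw [← ofFn_phi_inl hp, ← ofFn_phi_inl hq, h]
  · rw [← ofFn_phi_inr hp, ← ofFn_phi_inr hq, h]
  · rw [hp.2.1, hq.2.1]

theorem phi_mapsTo : Set.MapsTo (phi n d) (Schroder n d) (SortedRec n d) := by
  intro p hp
  obtain ⟨hU, hD, hH, hS⟩ := mem_Schroder_iff.1 hp
  have e1 := ofFn_phi_inl hp
  have e2 := ofFn_phi_inr hp
  rw [mem_SortedRec_iff, e1, e2]
  refine ⟨fun j => ?_, fun i => ?_, hS.countsCondition, ?_, ?_⟩
  · have := le_of_mem_uCounts p (phi n d p (Sum.inl j) + 1) (by rw [← e1]; simp)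
    omega
  · have := le_of_mem_hCounts p (phi n d p (Sum.inr i)) (by rw [← e2]; simp)
    omega
  · have := antitone_of_pairwise_ofFn (e1 ▸ pairwise_uCounts p)
    intro i j hij
    have := this hij
    simpa using this
  · exact antitone_of_pairwise_ofFn (e2 ▸ pairwise_hCounts p)

theorem phi_surjOn : Set.SurjOn (phi n d) (Schroder n d) (SortedRec n d) := by
  intro c hc
  obtain ⟨hA, hB, hcond, ha, hb⟩ := mem_SortedRec_iff.1 hc
  obtain ⟨p, h1, h2, h3⟩ := exists_word (List.ofFn fun j => c (Sum.inl j) + 1)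
    (List.ofFn fun i => c (Sum.inr i)) n
    (pairwise_ofFn_of_antitone fun i j hij => Nat.succ_le_succ (ha hij))
    (pairwise_ofFn_of_antitone hb)
    (by
      intro a ha
      obtain ⟨j, rfl⟩ := List.mem_ofFn.1 ha
      have := hA j
      simp
      omega)
    (by
      intro b hb
      obtain ⟨i, rfl⟩ := List.mem_ofFn.1 hb
      have := hB i
      omega)
  have hp : p ∈ Schroder n d := by
    refine mem_Schroder_iff.2 ⟨?_, h3, ?_, CountsCondition.suffixDominated ?_⟩
    · rw [← length_uCounts, h1, List.length_ofFn]
    · rw [← length_hCounts, h2, List.length_ofFn]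
    · rwa [h1, h2]
  refine ⟨p, hp, ?_⟩
  have e1 := List.ofFn_injective ((ofFn_phi_inl hp).trans h1)
  have e2 := List.ofFn_injective ((ofFn_phi_inr hp).trans h2)
  funext v
  cases v with
  | inl j => simpa using congrFun e1 j
  | inr i => exact congrFun e2 i

theorem phi_bijOn : Set.BijOn (phi n d) (Schroder n d) (SortedRec n d) :=
  ⟨phi_mapsTo, phi_injOn, phi_surjOn⟩

theorem phiInv_mem_and_phi_phiInv {c : Config n d} (hc : c ∈ SortedRec n d) :
    phiInv n d c ∈ Schroder n d ∧ phi n d (phiInv n d c) = c :=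
  ⟨Function.invFunOn_mem (phi_surjOn hc), Function.invFunOn_eq (phi_surjOn hc)⟩

end Phi

/-! ### Letters before a given `D`, and the toppling recursion -/

/-- The number of letters `s` (other than `D`) preceding the `(m+1)`st letter `D`. -/
def countBefore (s : Letter) : List Letter → ℕ → ℕ
  | [], _ => 0
  | Letter.U :: p, m => countBefore s p m + if s = Letter.U then 1 else 0
  | Letter.H :: p, m => countBefore s p m + if s = Letter.H then 1 else 0
  | Letter.D :: _, 0 => 0
  | Letter.D :: p, m + 1 => countBefore s p m

/-- An `H` lies before the `(m+1)`st `D` iff at most `m` letters `D` precede it. -/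
theorem lt_countBefore_H_iff (p : List Letter) (m i : ℕ) (hi : i < p.count Letter.H) :
    i < countBefore Letter.H p m ↔ p.count Letter.D ≤ (hCounts p).getD i 0 + m := by
  induction p generalizing m i with
  | nil => simp at hi
  | cons x p ih =>
    cases x
    · simpa [countBefore] using ih m i (by simpa using hi)
    · cases i with
      | zero => simp [countBefore]
      | succ i => simpa [countBefore] using ih m i (by simpa using hi)
    · have hi' : i < p.count Letter.H := by simpa using hi
      cases m with
      | zero =>
        have := le_of_mem_hCounts p ((hCounts p).getD i 0) (by
          rw [List.getD_eq_getElem _ _ (by rwa [length_hCounts])]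
          exact List.getElem_mem _)
        simp only [countBefore, hCounts_D, List.count_cons_self]
        omega
      | succ m =>
        have := ih m i hi'
        simp only [countBefore, hCounts_D, List.count_cons_self]
        omega

/-- The letters other than `U` before the `(m+1)`st `D` are `m` letters `D` and `countBefore
Letter.H p m` letters `H`; a `U` lies before that `D` iff no more than these precede it. -/
theorem lt_countBefore_U_iff (p : List Letter) (m j : ℕ) (hj : j < p.count Letter.U) :
    j < countBefore Letter.U p m ↔
      p.count Letter.H + p.count Letter.D ≤
        (uCounts p).getD j 0 + countBefore Letter.H p m + m := by
  induction p generalizing m j with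
  | nil => simp at hj
  | cons x p ih =>
    cases x
    · cases j with
      | zero => simp [countBefore]; omega
      | succ j => simpa [countBefore] using ih m j (by simpa using hj)
    · have := ih m j (by simpa using hj)
      simp only [countBefore, uCounts_H, List.count_cons_self, if_true, reduceCtorEq, if_false,
        List.count_cons_of_ne (show Letter.H ≠ Letter.D by decide)]
      omega
    · have hj' : j < p.count Letter.U := by simpa using hj
      cases m with
      | zero =>
        have := le_of_mem_uCounts p ((uCounts p).getD j 0) (by
          rw [List.getD_eq_getElem _ _ (by rwa [length_uCounts])]
          exact List.getElem_mem _)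
        simp only [countBefore, uCounts_D, List.count_cons_self,
          List.count_cons_of_ne (show Letter.D ≠ Letter.H by decide)]
        omega
      | succ m =>
        have := ih m j hj'
        simp only [countBefore, uCounts_D, List.count_cons_self,
          List.count_cons_of_ne (show Letter.D ≠ Letter.H by decide)]
        omega

theorem countBefore_le (s : Letter) (p : List Letter) (m : ℕ) : countBefore s p m ≤ p.count s := by
  induction p generalizing m with
  | nil => simp [countBefore]
  | cons x p ih =>
    have h0 := ih m
    cases x
    · cases s <;> simpa [countBefore] using h0
    · cases s <;> simpa [countBefore] using h0
    · cases m with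
      | zero => simp [countBefore]
      | succ m =>
        rw [countBefore, List.count_cons]
        exact (ih m).trans (Nat.le_add_right _ _)

theorem countBefore_mono (s : Letter) (p : List Letter) : Monotone (countBefore s p) := by
  induction p with
  | nil => exact monotone_const
  | cons x p ih =>
    intro a b hab
    cases x
    · exact Nat.add_le_add_right (ih hab) _
    · exact Nat.add_le_add_right (ih hab) _
    · cases a with
      | zero => exact Nat.zero_le _
      | succ a =>
        cases b with
        | zero => omega
        | succ b => exact ih (by omega : a ≤ b)

theorem countBefore_of_count_le {s : Letter} (hs : s ≠ Letter.D) (p : List Letter) (m : ℕ)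
    (hm : p.count Letter.D ≤ m) : countBefore s p m = p.count s := by
  induction p generalizing m with
  | nil => simp [countBefore]
  | cons x p ih =>
    cases x
    · have h0 := ih m (by simpa using hm)
      cases s <;> simpa [countBefore] using h0
    · have h0 := ih m (by simpa using hm)
      cases s <;> simpa [countBefore] using h0
    · cases m with
      | zero => simp at hm
      | succ m =>
        rw [countBefore, List.count_cons_of_ne hs.symm]
        exact ih m (by simpa using hm)

theorem countBefore_append {s : Letter} (hs : s ≠ Letter.D) (l r : List Letter) :
    countBefore s (l ++ Letter.D :: r) (l.count Letter.D) = l.count s := by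
  induction l with
  | nil => simp [countBefore]
  | cons x l ih =>
    cases x
    · cases s <;> simpa [countBefore] using ih
    · cases s <;> simpa [countBefore] using ih
    · rw [List.cons_append, List.count_cons_self, countBefore, List.count_cons_of_ne hs.symm, ih]

theorem exists_eq_append_cons (s : Letter) (p : List Letter) (m : ℕ) (hm : m < p.count s) :
    ∃ l r, p = l ++ s :: r ∧ l.count s = m := by
  induction p generalizing m with
  | nil => simp at hm
  | cons x p ih =>
    by_cases hx : x = s
    · subst hx
      cases m with
      | zero => exact ⟨[], p, rfl, rfl⟩
      | succ m =>
        obtain ⟨l, r, rfl, h⟩ := ih m (by simpa using hm)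
        exact ⟨x :: l, r, rfl, by simp [h]⟩
    · obtain ⟨l, r, rfl, h⟩ := ih m (by rwa [List.count_cons_of_ne hx] at hm)
      exact ⟨x :: l, r, rfl, by rw [List.count_cons_of_ne hx, h]⟩

/-- The prefix ending in the `(m+1)`st `D` contains at least `m + 1` letters `U`. Thus each loop
topples a clique vertex as long as one is left, and `n` loops exhaust them. -/
theorem lt_countBefore_U {n d : ℕ} {p : List Letter} (hp : p ∈ Schroder n d) {m : ℕ}
    (hm : m < n) : m < countBefore Letter.U p m := by
  obtain ⟨-, hD, -, hpre⟩ := hp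
  obtain ⟨l, r, rfl, rfl⟩ := exists_eq_append_cons Letter.D p m (by omega)
  rw [countBefore_append (by decide)]
  have := hpre (l ++ [Letter.D]) ⟨r, by simp⟩
  simp at this
  omega

/-- The number of clique vertices toppled in the first `k` loops. -/
def firedU (p : List Letter) (k : ℕ) : ℕ := (countBefore Letter.U p)^[k] 0

/-- The number of independent vertices toppled in the first `k` loops. -/
def firedH (p : List Letter) : ℕ → ℕ
  | 0 => 0
  | k + 1 => countBefore Letter.H p (firedU p k)

theorem firedU_succ (p : List Letter) (k : ℕ) :
    firedU p (k + 1) = countBefore Letter.U p (firedU p k) :=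
  Function.iterate_succ_apply' _ _ _

theorem firedU_mono (p : List Letter) : Monotone (firedU p) := by
  refine monotone_nat_of_le_succ fun k => ?_
  induction k with
  | zero => exact Nat.zero_le _
  | succ k ih =>
    rw [firedU_succ p k, firedU_succ p (k + 1)]
    exact countBefore_mono _ _ ih

theorem firedH_mono (p : List Letter) : Monotone (firedH p) := by
  refine monotone_nat_of_le_succ fun k => ?_
  cases k with
  | zero => exact Nat.zero_le _
  | succ k => exact countBefore_mono _ _ (firedU_mono p (Nat.le_succ k))

theorem firedU_le (p : List Letter) (k : ℕ) : firedU p k ≤ p.count Letter.U := by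
  cases k with
  | zero => exact Nat.zero_le _
  | succ k =>
    rw [firedU_succ]
    exact countBefore_le _ _ _

theorem firedH_le (p : List Letter) (k : ℕ) : firedH p k ≤ p.count Letter.H := by
  cases k with
  | zero => exact Nat.zero_le _
  | succ k => exact countBefore_le _ _ _

theorem le_firedU {n d : ℕ} {p : List Letter} (hp : p ∈ Schroder n d) {k : ℕ} (hk : k ≤ n) :
    k ≤ firedU p k := by
  induction k with
  | zero => exact Nat.zero_le _
  | succ k ih =>
    rw [firedU_succ]
    have h1 := lt_countBefore_U hp hk
    have h2 := countBefore_mono Letter.U p (ih (by omega))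
    omega

theorem firedU_eq_of_le {n d : ℕ} {p : List Letter} (hp : p ∈ Schroder n d) {k : ℕ}
    (hk : n ≤ k) : firedU p k = n := by
  have h1 := firedU_le p k
  have h2 := firedU_mono p hk
  have h3 := le_firedU hp (le_refl n)
  rw [hp.1] at h1
  omega

theorem firedH_succ_eq {n d : ℕ} {p : List Letter} (hp : p ∈ Schroder n d) {k : ℕ}
    (hk : firedU p k = n) : firedH p (k + 1) = d := by
  rw [firedH, hk, countBefore_of_count_le (by decide) _ _ hp.2.1.le, hp.2.2.1]

/-! ### ITC toppling read on the word -/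

section Toppling

variable {n d : ℕ}

/-- The configuration after toppling the sink, the first `P` clique vertices and the
first `Q` independent vertices. -/
def fired (c : Config n d) (P Q : ℕ) : Config n d :=
  Sum.elim
    (fun j => c (Sum.inl j) + 1 + Q + P - if j.val < P then n + d + 1 else 0)
    (fun i => c (Sum.inr i) + 1 + P - if i.val < Q then n + 1 else 0)

/-- The indices `k` with `a ≤ k < b`. -/
def finIco (m a b : ℕ) : Finset (Fin m) := Finset.univ.filter fun k => a ≤ k.val ∧ k.val < b

theorem card_finIco {m a b : ℕ} (hb : b ≤ m) : (finIco m a b).card = b - a := by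
  rw [← Nat.card_Ico, ← Finset.card_map Fin.valEmbedding]
  congr 1
  ext k
  simp only [finIco, Finset.mem_map, Finset.mem_filter, Finset.mem_univ, true_and,
    Fin.valEmbedding_apply, Finset.mem_Ico]
  constructor
  · rintro ⟨x, hx, rfl⟩
    exact hx
  · intro h
    exact ⟨⟨k, by omega⟩, h, rfl⟩

theorem topple_eq (c : Config n d) (A : Finset (Fin n ⊕ Fin d)) (u : Fin n ⊕ Fin d) :
    topple (splitGraph n d) c A u = c u + degIn (splitGraph n d) A u -
      if u ∈ A then (splitGraph n d).degree (some u) else 0 := rfl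

theorem toppleSink_eq_fired (c : Config n d) : toppleSink (splitGraph n d) c = fired c 0 0 := by
  funext u
  rw [toppleSink, if_pos (splitGraph_adj_none u)]
  cases u <;> simp [fired]

theorem toppleIndep_fired {c : Config n d} {P Q Q' : ℕ} (hQ : Q ≤ Q') (hQ' : Q' ≤ d)
    (h : unstableIndep (fired c P Q) = Finset.disjSum ∅ (finIco d Q Q'))
    (hP : ∀ j : Fin n, j.val < P → n + d ≤ c (Sum.inl j) + Q + P) :
    toppleIndep (fired c P Q) = fired c P Q' := by
  funext u
  rw [toppleIndep, topple_eq, h]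
  cases u with
  | inl j =>
    have := hP j
    rw [degIn_inl, Finset.erase_eq_of_notMem (by simp), if_neg (by simp), Finset.card_disjSum,
      card_finIco hQ']
    simp only [fired, Sum.elim_inl, Finset.card_empty]
    split_ifs <;> omega
  | inr i =>
    rw [degIn_inr, degree_inr, Finset.toLeft_disjSum]
    simp only [fired, Sum.elim_inr, Finset.card_empty, Finset.inr_mem_disjSum, finIco,
      Finset.mem_filter, Finset.mem_univ, true_and]
    split_ifs <;> omega

theorem toppleClique_fired {c : Config n d} {P P' Q : ℕ} (hP : P ≤ P') (hP' : P' ≤ n)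
    (h : unstableClique (fired c P Q) = Finset.disjSum (finIco n P P') ∅)
    (hj : ∀ j : Fin n, j.val < P → n + d ≤ c (Sum.inl j) + Q + P)
    (hi : ∀ i : Fin d, i.val < Q → n ≤ c (Sum.inr i) + P) :
    toppleClique (fired c P Q) = fired c P' Q := by
  funext u
  rw [toppleClique, topple_eq, h]
  cases u with
  | inl j =>
    have := hj j
    have hmem : (Sum.inl j : Fin n ⊕ Fin d) ∈ Finset.disjSum (finIco n P P') ∅ ↔
        P ≤ j.val ∧ j.val < P' := by simp [finIco]
    rw [degIn_inl, degree_inl, Finset.card_erase_eq_ite, Finset.card_disjSum, card_finIco hP']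
    simp only [fired, Sum.elim_inl, Finset.card_empty, hmem]
    split_ifs <;> omega
  | inr i =>
    have := hi i
    rw [degIn_inr, Finset.toLeft_disjSum, card_finIco hP', if_neg (by simp)]
    simp only [fired, Sum.elim_inr]
    split_ifs <;> omega

theorem fired_all (c : Config n d) : fired c n d = c := by
  funext u
  cases u with
  | inl j =>
    simp only [fired, Sum.elim_inl, if_pos j.isLt]
    omega
  | inr i =>
    simp only [fired, Sum.elim_inr, if_pos i.isLt]
    omega

theorem phi_inl_add_one {p : List Letter} (hp : p ∈ Schroder n d)
    (j : Fin n) : phi n d p (Sum.inl j) + 1 = (uCounts p).getD j 0 := by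
  have h : j.val < (uCounts p).length := by
    rw [length_uCounts, hp.1]
    exact j.isLt
  have := (mem_Schroder_iff.1 hp).2.2.2.pos_of_mem_uCounts _ (List.getElem_mem h)
  rw [phi_inl, List.getD_eq_getElem _ _ h]
  omega

theorem phi_bounds {p : List Letter} (hp : p ∈ Schroder n d) :
    (∀ j, phi n d p (Sum.inl j) < n + d) ∧ ∀ i, phi n d p (Sum.inr i) < n + 1 :=
  ⟨(mem_SortedRec_iff.1 (phi_mapsTo hp)).1, (mem_SortedRec_iff.1 (phi_mapsTo hp)).2.1⟩

theorem lt_countBefore_H_iff_phi {p : List Letter} (hp : p ∈ Schroder n d) (i : Fin d) (P : ℕ) :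
    i.val < countBefore Letter.H p P ↔ n ≤ phi n d p (Sum.inr i) + P := by
  rw [lt_countBefore_H_iff p P i (by rw [hp.2.2.1]; exact i.isLt), hp.2.1, phi_inr]

theorem lt_countBefore_U_iff_phi {p : List Letter} (hp : p ∈ Schroder n d) (j : Fin n) (P : ℕ) :
    j.val < countBefore Letter.U p P ↔
      n + d ≤ phi n d p (Sum.inl j) + 1 + countBefore Letter.H p P + P := by
  rw [lt_countBefore_U_iff p P j (by rw [hp.1]; exact j.isLt), hp.2.1, hp.2.2.1,
    phi_inl_add_one hp, add_comm d n]

/-- A vertex already toppled stays below its degree, since `c ≤ n` and `P ≤ n`. For the others,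
instability is the inequality of `lt_countBefore_H_iff_phi`. -/
theorem unstableIndep_fired {p : List Letter} (hp : p ∈ Schroder n d) {P Q : ℕ} (hP : P ≤ n) :
    unstableIndep (fired (phi n d p) P Q) =
      Finset.disjSum ∅ (finIco d Q (countBefore Letter.H p P)) := by
  ext u
  cases u with
  | inl j => simp [unstableIndep]
  | inr i =>
    have h1 := (phi_bounds hp).2 i
    have h2 := lt_countBefore_H_iff_phi hp i P
    rw [unstableIndep, Finset.mem_filter]
    simp only [StableAt, degree_inr, Finset.mem_filter, Finset.mem_univ, true_and,
      Sum.isRight_inr, Finset.inr_mem_disjSum, finIco, fired, Sum.elim_inr, h2]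
    split_ifs <;> omega

theorem unstableClique_fired {p : List Letter} (hp : p ∈ Schroder n d) {P : ℕ} (hP : P ≤ n) :
    unstableClique (fired (phi n d p) P (countBefore Letter.H p P)) =
      Finset.disjSum (finIco n P (countBefore Letter.U p P)) ∅ := by
  ext u
  cases u with
  | inl j =>
    have h1 := (phi_bounds hp).1 j
    have h2 := lt_countBefore_U_iff_phi hp j P
    have h3 := countBefore_le Letter.H p P
    rw [hp.2.2.1] at h3
    rw [unstableClique, Finset.mem_filter]
    simp only [StableAt, degree_inl, Finset.mem_filter, Finset.mem_univ, true_and,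
      Sum.isLeft_inl, Finset.inl_mem_disjSum, finIco, fired, Sum.elim_inl, h2]
    split_ifs <;> omega
  | inr i => simp [unstableClique]

/-- Needed for the subtraction in `fired` to be exact. The instability criterion for the latest loop
gives the bound with a spare `+ 1`, the grain of the sink; the strict growth of the clique count in
that loop makes up for it. -/
theorem le_phi_inl_of_lt_firedU {p : List Letter} (hp : p ∈ Schroder n d)
    (k : ℕ) (j : Fin n) (hj : j.val < firedU p k) :
    n + d ≤ phi n d p (Sum.inl j) + firedH p k + firedU p k := by
  cases k with
  | zero => exact absurd hj (Nat.not_lt_zero _)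
  | succ k =>
    rcases lt_or_ge (firedU p k) n with h | h
    · have h1 := lt_countBefore_U hp h
      rw [firedU_succ] at hj ⊢
      have h2 := (lt_countBefore_U_iff_phi hp j _).1 hj
      rw [firedH]
      omega
    -- All clique vertices had toppled before this loop, so the last two summands are already `d`
    -- and `n`.
    · have h1 := firedU_le p k
      have h2 := firedU_le p (k + 1)
      have h3 := firedU_mono p (Nat.le_succ k)
      rw [hp.1] at h1 h2
      rw [firedH_succ_eq hp (by omega)]
      simp only [Nat.succ_eq_add_one] at h3
      omega

theorem toppleIndep_fired_phi {p : List Letter} (hp : p ∈ Schroder n d) (k : ℕ) :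
    toppleIndep (fired (phi n d p) (firedU p k) (firedH p k)) =
      fired (phi n d p) (firedU p k) (firedH p (k + 1)) := by
  have h1 := firedU_le p k
  have h2 := firedH_le p (k + 1)
  rw [hp.1] at h1
  rw [hp.2.2.1] at h2
  exact toppleIndep_fired (firedH_mono p (Nat.le_succ k)) h2 (unstableIndep_fired hp h1)
    (le_phi_inl_of_lt_firedU hp k)

theorem itcState_phi {p : List Letter} (hp : p ∈ Schroder n d) (k : ℕ) :
    itcState (phi n d p) k = fired (phi n d p) (firedU p k) (firedH p k) := by
  induction k with
  | zero => exact toppleSink_eq_fired _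
  | succ k ih =>
    have h1 := firedU_le p k
    have h3 := firedU_le p (k + 1)
    rw [hp.1] at h1 h3
    have e : itcState (phi n d p) (k + 1) =
        toppleClique (toppleIndep (itcState (phi n d p) k)) :=
      Function.iterate_succ_apply' _ _ _
    rw [e, ih, toppleIndep_fired_phi hp]
    refine toppleClique_fired (firedU_mono p (Nat.le_succ k)) h3 ?_ ?_ ?_
    · rw [firedU_succ]
      exact unstableClique_fired hp h1
    · intro j hj
      have h4 := le_phi_inl_of_lt_firedU hp k j hj
      have h5 : firedH p k ≤ firedH p (k + 1) := firedH_mono p (Nat.le_succ k)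
      omega
    · intro i hi
      exact (lt_countBefore_H_iff_phi hp i _).1 hi

theorem card_itcQ_phi {p : List Letter} (hp : p ∈ Schroder n d) (k : ℕ) :
    (itcQ (phi n d p) k).card = firedH p (k + 1) - firedH p k := by
  have h1 := firedU_le p k
  have h2 := firedH_le p (k + 1)
  rw [hp.1] at h1
  rw [hp.2.2.1] at h2
  rw [itcQ, itcState_phi hp, unstableIndep_fired hp h1, Finset.card_disjSum, Finset.card_empty,
    zero_add]
  exact card_finIco h2

theorem card_itcP_phi {p : List Letter} (hp : p ∈ Schroder n d) (k : ℕ) :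
    (itcP (phi n d p) k).card = firedU p (k + 1) - firedU p k := by
  have h1 := firedU_le p k
  have h2 := firedU_le p (k + 1)
  rw [hp.1] at h1 h2
  rw [firedU_succ] at h2 ⊢
  rw [itcP, itcState_phi hp, toppleIndep_fired_phi hp, firedH, unstableClique_fired hp h1,
    Finset.card_disjSum, Finset.card_empty, add_zero, card_finIco h2]

theorem isStable_phi {p : List Letter} (hp : p ∈ Schroder n d)
    : IsStable (splitGraph n d) (phi n d p) :=
  (isStable_splitGraph_iff _).2 (phi_bounds hp)

theorem isStable_itcState_phi {p : List Letter} (hp : p ∈ Schroder n d)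
    : IsStable (splitGraph n d) (itcState (phi n d p) (n + 1)) := by
  rw [itcState_phi hp, firedU_eq_of_le hp (Nat.le_succ n),
    firedH_succ_eq hp (firedU_eq_of_le hp le_rfl), fired_all]
  exact isStable_phi hp

/-- In a stable state the next loop topples nothing, so the clique count is a fixed point of
`countBefore Letter.U p`; below `n` there is none. Hence the process cannot stop before every vertex
has toppled. -/
theorem fired_eq_of_isStable {p : List Letter} (hp : p ∈ Schroder n d)
    {k : ℕ} (h : IsStable (splitGraph n d) (itcState (phi n d p) k)) :
    firedU p k = n ∧ firedH p k = d := by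
  have hQ : itcQ (phi n d p) k = ∅ := by
    rw [itcQ, unstableIndep, Finset.filter_eq_empty_iff]
    exact fun v _ hv => hv.2 (h v)
  have hQ' := card_itcQ_phi hp k
  rw [hQ, Finset.card_empty] at hQ'
  have hHm : firedH p k ≤ firedH p (k + 1) := firedH_mono p (Nat.le_succ k)
  have hHe : firedH p (k + 1) = firedH p k := by omega
  -- As the independent phase changes nothing, the clique phase also starts from the stable state.
  have hP : itcP (phi n d p) k = ∅ := by
    rw [itcP, itcState_phi hp, toppleIndep_fired_phi hp, hHe, ← itcState_phi hp, unstableClique,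
      Finset.filter_eq_empty_iff]
    exact fun v _ hv => hv.2 (h v)
  have hP' := card_itcP_phi hp k
  rw [hP, Finset.card_empty, firedU_succ] at hP'
  have hle := firedU_le p k
  rw [hp.1] at hle
  have hU : firedU p k = n := by
    by_contra hne
    have := lt_countBefore_U hp (lt_of_le_of_ne hle hne)
    omega
  exact ⟨hU, by rw [← hHe, firedH_succ_eq hp hU]⟩

/-- Summation by parts, with `x k` the number of vertices toppled in the first `k` loops: a vertex
toppled in loop `i` counts once in `X` and once for each of the `i - 1` loops after which it is
still untoppled. Beyond `t` the increments vanish, so the exact stopping time is irrelevant. -/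
theorem sum_mul_sub_eq {x : ℕ → ℕ} (hx : Monotone x) (h0 : x 0 = 0) {X t N : ℕ}
    (hX : ∀ k, x k ≤ X) (ht : x t = X) (htN : t ≤ N + 1) :
    ∑ k ∈ Finset.range t, (k + 1) * (x (k + 1) - x k) =
      X + ∑ k ∈ Finset.range N, (X - x (k + 1)) := by
  have hconst : ∀ k, t ≤ k → x k = X := fun k hk => le_antisymm (hX k) (ht ▸ hx hk)
  have h1 : ∑ k ∈ Finset.range t, (k + 1) * (x (k + 1) - x k) =
      ∑ k ∈ Finset.range (N + 1), (k + 1) * (x (k + 1) - x k) := by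
    refine Finset.sum_subset (Finset.range_mono htN) fun k _ hk => ?_
    have hk' : t ≤ k := by simpa using hk
    rw [hconst k hk', hconst (k + 1) (by omega), Nat.sub_self, mul_zero]
  have h2 : ∀ m, ∑ k ∈ Finset.range m, (k + 1) * (x (k + 1) - x k) +
      ∑ k ∈ Finset.range m, x k = m * x m := by
    intro m
    induction m with
    | zero => simp
    | succ m ih =>
      rw [Finset.sum_range_succ, Finset.sum_range_succ]
      obtain ⟨e, he⟩ := Nat.exists_eq_add_of_le (hx (Nat.le_succ m))
      simp only [Nat.succ_eq_add_one] at he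
      rw [he, Nat.add_sub_cancel_left]
      linear_combination ih
  have h3 : ∑ k ∈ Finset.range N, (X - x (k + 1)) + ∑ k ∈ Finset.range (N + 1), x k = N * X := by
    rw [Finset.sum_range_succ', h0, add_zero, ← Finset.sum_add_distrib]
    rw [Finset.sum_congr rfl fun k _ => Nat.sub_add_cancel (hX (k + 1))]
    simp
  have h4 := h2 (N + 1)
  rw [hconst (N + 1) htN] at h4
  rw [h1]
  linarith

theorem wtoppleITC_phi {p : List Letter} (hp : p ∈ Schroder n d) :
    wtoppleITC (phi n d p) = (n + d) + (∑ k ∈ Finset.range n, (n - firedU p (k + 1)) +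
      ∑ k ∈ Finset.range n, (d - firedH p (k + 1))) := by
  have hne : {k | IsStable (splitGraph n d) (itcState (phi n d p) k)}.Nonempty :=
    ⟨n + 1, isStable_itcState_phi hp⟩
  obtain ⟨hU, hH⟩ := fired_eq_of_isStable hp (Nat.sInf_mem hne)
  have hle : itcLength (phi n d p) ≤ n + 1 := Nat.sInf_le (isStable_itcState_phi hp)
  have e1 := sum_mul_sub_eq (firedU_mono p) rfl
    (fun k => (firedU_le p k).trans hp.1.le) hU hle
  have e2 := sum_mul_sub_eq (firedH_mono p) rfl
    (fun k => (firedH_le p k).trans hp.2.2.1.le) hH hle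
  unfold itcLength at e1 e2 hle
  rw [wtoppleITC]
  simp only [card_itcQ_phi hp, card_itcP_phi hp, mul_add, Finset.sum_add_distrib]
  unfold itcLength
  omega

end Toppling

/-! ### The mirror image and its bounce path -/

theorem mirror_append (l r : List Letter) : mirror (l ++ r) = mirror r ++ mirror l := by
  simp [mirror]

theorem mirror_cons (x : Letter) (p : List Letter) :
    mirror (x :: p) = mirror p ++ [mirrorLetter x] := by
  simp [mirror]

theorem mirrorLetter_mirrorLetter (x : Letter) : mirrorLetter (mirrorLetter x) = x := by
  cases x <;> rfl

theorem mirror_mirror (p : List Letter) : mirror (mirror p) = p := by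
  have : mirrorLetter ∘ mirrorLetter = id := funext mirrorLetter_mirrorLetter
  simp [mirror, ← List.map_reverse, this]

theorem count_mirror (s : Letter) (p : List Letter) :
    (mirror p).count s = p.count (mirrorLetter s) := by
  induction p with
  | nil => rfl
  | cons x p ih =>
    rw [mirror_cons, List.count_append, ih]
    cases x <;> cases s <;> simp [mirrorLetter]

theorem mirror_mem_Schroder {n d : ℕ} {p : List Letter} (hp : p ∈ Schroder n d) :
    mirror p ∈ Schroder n d := by
  obtain ⟨hU, hD, hH, hS⟩ := mem_Schroder_iff.1 hp
  refine ⟨by rw [count_mirror]; exact hD, by rw [count_mirror]; exact hU,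
    by rw [count_mirror]; exact hH, ?_⟩
  rintro q ⟨s, hs⟩
  have := hS (mirror q) ⟨mirror s, by rw [← mirror_append, hs, mirror_mirror]⟩
  rwa [count_mirror, count_mirror] at this

theorem westEnd_zero (q : List Letter) : westEnd q 0 = 0 := by cases q <;> rfl

theorem westEnd_collapse (w : List Letter) (m : ℕ) : westEnd (collapse w) m = westEnd w m := by
  induction w generalizing m with
  | nil => rfl
  | cons x w ih =>
    cases m with
    | zero => rw [westEnd_zero, westEnd_zero]
    | succ m =>
      unfold collapse at ih ⊢
      cases x <;> simpa [westEnd] using ih _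

theorem westEnd_append (l r : List Letter) :
    westEnd (l ++ Letter.U :: r) (l.count Letter.U + 1) = l.count Letter.D := by
  induction l with
  | nil => simp [westEnd, westEnd_zero]
  | cons x l ih => cases x <;> simp [westEnd, ih]

/-- How the counts before a letter `U` of the mirror image are seen in the original word. -/
theorem count_add_countBefore_of_mirror_eq {p a b : List Letter}
    (h : mirror p = a ++ Letter.U :: b) {s : Letter} (hs : s ≠ Letter.D) :
    a.count (mirrorLetter s) +
      countBefore s p (p.count Letter.D - (a.count Letter.U + 1)) = p.count s := by
  -- The chosen `U` of the mirror image is a `D` of `p`, with before and after exchanged.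
  have hp : p = mirror b ++ Letter.D :: mirror a := by
    rw [← mirror_mirror p, h, mirror_append, mirror_cons, List.append_assoc]
    rfl
  have hD : p.count Letter.D - (a.count Letter.U + 1) = (mirror b).count Letter.D := by
    rw [hp, List.count_append, List.count_cons_self, count_mirror, count_mirror]
    simp only [mirrorLetter]
    omega
  rw [hD]
  conv_lhs => rw [hp]
  rw [countBefore_append hs, hp, List.count_append, List.count_cons_of_ne hs.symm, count_mirror s a]
  omega

/-- For `m > 0`, the `m`th `U` of the mirror image is the `(n-m+1)`st `D` of `p`, and the `D`'s
before the former are the `U`'s after the latter. So a bounce step is the toppling recursion in the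
coordinate `n - m`. -/
theorem westEnd_mirror {n d : ℕ} {p : List Letter} (hp : p ∈ Schroder n d) {m : ℕ} (hm : m ≤ n) :
    westEnd (mirror p) m = n - countBefore Letter.U p (n - m) := by
  cases m with
  | zero =>
    rw [westEnd_zero, Nat.sub_zero, countBefore_of_count_le (by decide) _ _ hp.2.1.le, hp.1,
      Nat.sub_self]
  | succ m =>
    obtain ⟨a, b, h, ha⟩ := exists_eq_append_cons Letter.U (mirror p) m (by
      rw [(mirror_mem_Schroder hp).1]
      omega)
    have := count_add_countBefore_of_mirror_eq h (s := Letter.U) (by decide)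
    rw [hp.1, hp.2.1, ha] at this
    rw [h, ← ha, westEnd_append, ha]
    simp only [mirrorLetter] at this
    omega

theorem count_U_collapse (w : List Letter) : (collapse w).count Letter.U = w.count Letter.U :=
  List.count_filter (by decide)

theorem diagPoint_collapse_mirror {n d : ℕ} {p : List Letter} (hp : p ∈ Schroder n d) (i : ℕ) :
    diagPoint (collapse (mirror p)) i = n - firedU p i := by
  induction i with
  | zero =>
    change (collapse (mirror p)).count Letter.U = n - 0
    rw [count_U_collapse, (mirror_mem_Schroder hp).1, Nat.sub_zero]
  | succ i ih =>
    have e : diagPoint (collapse (mirror p)) (i + 1) =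
        westEnd (collapse (mirror p)) (diagPoint (collapse (mirror p)) i) :=
      Function.iterate_succ_apply' _ _ _
    have hle := firedU_le p i
    rw [hp.1] at hle
    rw [e, ih, westEnd_collapse, westEnd_mirror hp (Nat.sub_le _ _), Nat.sub_sub_self hle,
      firedU_succ]

theorem dyckBounce_collapse_mirror {n d : ℕ} {p : List Letter} (hp : p ∈ Schroder n d) :
    dyckBounce (collapse (mirror p)) = ∑ k ∈ Finset.range n, (n - firedU p (k + 1)) := by
  rw [dyckBounce, count_U_collapse, (mirror_mem_Schroder hp).1]
  exact Finset.sum_congr rfl fun k _ => diagPoint_collapse_mirror hp _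

theorem take_succ_of_getElem?_eq {w : List Letter} {k : ℕ} {x : Letter} (h : w[k]? = some x) :
    w.take (k + 1) = w.take k ++ [x] := by
  rw [List.take_add_one, h]
  rfl

theorem card_filter_getElem?_eq (w : List Letter) (s : Letter) (m : ℕ) :
    ((Finset.range m).filter fun k => w[k]? = some s).card = (w.take m).count s := by
  induction m with
  | zero => simp
  | succ m ih =>
    rw [Finset.range_add_one, Finset.filter_insert, List.take_add_one, List.count_append, ← ih]
    split_ifs with h
    · rw [Finset.card_insert_of_notMem (by simp), h]
      simp
    · cases h' : w[m]? with
      | none => simp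
      | some x =>
        have hx : x ≠ s := fun e => h (by rw [h', e])
        simp [hx]

theorem count_take_mono (s : Letter) (w : List Letter) {k l : ℕ} (h : k ≤ l) :
    (w.take k).count s ≤ (w.take l).count s :=
  (List.take_prefix_take_left h).sublist.count_le s

theorem xEnd_take_mono (w : List Letter) {k l : ℕ} (h : k ≤ l) :
    xEnd (w.take k) ≤ xEnd (w.take l) :=
  Nat.add_le_add (count_take_mono _ _ h) (count_take_mono _ _ h)

theorem yEnd_take_mono (w : List Letter) {k l : ℕ} (h : k ≤ l) :
    yEnd (w.take k) ≤ yEnd (w.take l) :=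
  Nat.add_le_add (count_take_mono _ _ h) (count_take_mono _ _ h)

theorem yEnd_lt_yEnd_iff {w : List Letter} {k l : ℕ}
    (hl : w[l]? = some Letter.U) : yEnd (w.take (k + 1)) < yEnd (w.take (l + 1)) ↔ k < l := by
  constructor
  · intro h
    by_contra hlt
    have := yEnd_take_mono w (show l + 1 ≤ k + 1 by omega)
    omega
  · intro h
    have h1 := yEnd_take_mono w (show k + 1 ≤ l by omega)
    have h2 : yEnd (w.take (l + 1)) = yEnd (w.take l) + 1 := by
      rw [take_succ_of_getElem?_eq hl]
      simp [yEnd]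
      omega
    omega

/-- Double counting of pairs (`H` step, peak): a peak is above an `H` step iff it comes later in the
word. -/
theorem sum_peaksAbove_eq (w : List Letter) :
    ∑ k ∈ (Finset.range w.length).filter (fun k => w[k]? = some Letter.H), peaksAbove w k =
      ∑ l ∈ peaks w, (w.take l).count Letter.H := by
  unfold peaksAbove
  refine (Finset.sum_card_bipartiteAbove_eq_sum_card_bipartiteBelow
    (fun k l => yEnd (w.take (k + 1)) < yEnd (w.take (l + 1)))).trans
      (Finset.sum_congr rfl fun l hl => ?_)
  obtain ⟨hl', hU, -⟩ := Finset.mem_filter.1 hl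
  rw [← card_filter_getElem?_eq]
  congr 1
  ext k
  simp only [Finset.bipartiteBelow, Finset.mem_filter, Finset.mem_range] at hl' ⊢
  constructor
  · rintro ⟨⟨-, hH⟩, hlt⟩
    exact ⟨(yEnd_lt_yEnd_iff hU).1 hlt, hH⟩
  · rintro ⟨hlt, hH⟩
    exact ⟨⟨by omega, hH⟩, (yEnd_lt_yEnd_iff hU).2 hlt⟩

/-- Used to pass from positions of peaks in the word to their heights in the collapsed path; a
letter `U` is determined by its rank among the `U`'s. -/
theorem sum_peaks_eq_sum_peakHeights {w : List Letter} {f g : ℕ → ℕ}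
    (hfg : ∀ l, w[l]? = some Letter.U → f l = g ((w.take (l + 1)).count Letter.U))
    (hle : ∀ m ∈ peakHeights (collapse w), 0 < m ∧ m ≤ w.count Letter.U) :
    ∑ l ∈ peaks w, f l = ∑ m ∈ peakHeights (collapse w), g m := by
  have hlt : ∀ l l', w[l']? = some Letter.U → l < l' →
      (w.take (l + 1)).count Letter.U < (w.take (l' + 1)).count Letter.U := by
    intro l l' h' hll
    have h1 := count_take_mono Letter.U w (show l + 1 ≤ l' by omega)
    rw [take_succ_of_getElem?_eq h', List.count_append]
    simp
    omega
  refine Finset.sum_nbij (fun l => (w.take (l + 1)).count Letter.U) ?_ ?_ ?_ ?_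
  · intro l hl
    exact (Finset.mem_filter.1 hl).2.2
  · intro l hl l' hl' heq
    have h1 := (Finset.mem_filter.1 hl).2.1
    have h2 := (Finset.mem_filter.1 hl').2.1
    simp only at heq
    rcases lt_trichotomy l l' with h | h | h
    · have := hlt l l' h2 h
      omega
    · exact h
    · have := hlt l' l h1 h
      omega
  · intro m hm
    have hm' := hle m hm
    obtain ⟨a, b, h, ha⟩ := exists_eq_append_cons Letter.U w (m - 1) (by omega)
    have hget : w[a.length]? = some Letter.U := by simp [h]
    have hcount : (w.take (a.length + 1)).count Letter.U = m := by
      rw [take_succ_of_getElem?_eq hget, h, List.take_left, List.count_append, ha]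
      simp
      omega
    refine ⟨a.length, Finset.mem_coe.2 (Finset.mem_filter.2 ⟨?_, hget, ?_⟩), hcount⟩
    · simp [h]
    · rw [hcount]
      exact hm
  · intro l hl
    exact hfg l (Finset.mem_filter.1 hl).2.1

theorem bounceSch_mirror {n d : ℕ} {p : List Letter} (hp : p ∈ Schroder n d) :
    bounceSch (mirror p) = ∑ k ∈ Finset.range n, (n - firedU p (k + 1)) +
      ∑ k ∈ Finset.range n, (d - firedH p (k + 1)) := by
  have hw := mirror_mem_Schroder hp
  rw [bounceSch, dyckBounce_collapse_mirror hp, sum_peaksAbove_eq]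
  congr 1
  rw [sum_peaks_eq_sum_peakHeights (g := fun m => d - countBefore Letter.H p (n - m))]
  · rw [peakHeights, count_U_collapse, hw.1, Finset.filter_image, Finset.sum_image,
      Finset.sum_filter_of_ne]
    · refine Finset.sum_congr rfl fun k _ => ?_
      have hle := firedU_le p k
      rw [hp.1] at hle
      rw [diagPoint_collapse_mirror hp, Nat.sub_sub_self hle, firedH]
    -- Once the bounce path is at the origin there is no peak, but the summand is zero as well: all
    -- `H`'s precede the missing `(n+1)`st `D`.
    · intro k _ hne
      by_contra h0
      refine hne ?_
      rw [Nat.eq_zero_of_not_pos h0, Nat.sub_zero,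
        countBefore_of_count_le (by decide) _ _ hp.2.1.le, hp.2.2.1, Nat.sub_self]
    -- The diagonal points strictly decrease until they reach `0`, so distinct indices give distinct
    -- peaks.
    · have key : ∀ i j, i < j → 0 < n - firedU p i → firedU p i < firedU p j := by
        intro i j hij hpos
        have h1 := lt_countBefore_U hp (show firedU p i < n by omega)
        rw [← firedU_succ] at h1
        exact h1.trans_le (firedU_mono p hij)
      intro i hi j hj heq
      have hi' := (Finset.mem_filter.1 hi).2
      have hj' := (Finset.mem_filter.1 hj).2
      rw [diagPoint_collapse_mirror hp] at hi' hj'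
      simp only [diagPoint_collapse_mirror hp] at heq
      rcases lt_trichotomy i j with h | h | h
      · have := key i j h hi'
        omega
      · exact h
      · have := key j i h hj'
        omega
  · intro l hl
    have hsplit : mirror p = (mirror p).take l ++ Letter.U :: (mirror p).drop (l + 1) := by
      conv_lhs => rw [← List.take_append_drop (l + 1) (mirror p)]
      rw [take_succ_of_getElem?_eq hl, List.append_assoc]
      rfl
    have := count_add_countBefore_of_mirror_eq hsplit (s := Letter.H) (by decide)
    rw [hp.2.1, hp.2.2.1] at this
    rw [take_succ_of_getElem?_eq hl, List.count_append]
    simp only [mirrorLetter, List.count_singleton_self] at this ⊢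
    omega
  · intro m hm
    obtain ⟨hm1, hm2⟩ := Finset.mem_filter.1 hm
    obtain ⟨i, -, rfl⟩ := Finset.mem_image.1 hm1
    rw [diagPoint_collapse_mirror hp] at hm2 ⊢
    rw [hw.1]
    exact ⟨hm2, Nat.sub_le _ _⟩

/-! ### Area and level -/

/-- The ordinate bounding from above the lower triangles below a last step `x` that follows
the path `w`. -/
def columnTop (w : List Letter) : Letter → ℕ
  | Letter.U => 0
  | Letter.H => yEnd w + 1
  | Letter.D => yEnd w

theorem isLowerTriangle_append_singleton (w : List Letter) (x : Letter) (i j : ℕ) :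
    IsLowerTriangle (w ++ [x]) i j ↔
      IsLowerTriangle w i j ∨ (i = xEnd w ∧ i + 1 ≤ j ∧ j < columnTop w x) := by
  have hlast : (w ++ [x])[w.length]? = some x := by simp
  constructor
  · rintro ⟨hij, k, hk, hx, h⟩
    rcases (Nat.lt_succ_iff_lt_or_eq.1 (by simpa using hk) : k < w.length ∨ k = w.length)
      with hk' | rfl
    · rw [List.take_append_of_le_length hk'.le] at hx h
      rw [List.getElem?_append_left hk'] at h
      exact Or.inl ⟨hij, k, hk', hx, h⟩
    · rw [List.take_left] at hx h
      rw [hlast] at h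
      refine Or.inr ⟨hx.symm, hij, ?_⟩
      cases x <;> simp [columnTop] at h ⊢ <;> omega
  · rintro (⟨hij, k, hk, hx, h⟩ | ⟨rfl, hij, h⟩)
    · refine ⟨hij, k, by simp; omega, ?_⟩
      rw [List.take_append_of_le_length hk.le, List.getElem?_append_left hk]
      exact ⟨hx, h⟩
    · refine ⟨hij, w.length, by simp, ?_⟩
      rw [List.take_left, hlast]
      refine ⟨rfl, ?_⟩
      cases x <;> simp [columnTop] at h ⊢ <;> omega

theorem xEnd_le_length (w : List Letter) : xEnd w ≤ w.length := by
  induction w with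
  | nil => rfl
  | cons x w ih =>
    unfold xEnd at *
    cases x <;> simp <;> omega

theorem yEnd_le_length (w : List Letter) : yEnd w ≤ w.length := by
  induction w with
  | nil => rfl
  | cons x w ih =>
    unfold yEnd at *
    cases x <;> simp <;> omega

theorem IsLowerTriangle.bounds {w : List Letter} {i j : ℕ} (h : IsLowerTriangle w i j) :
    i < xEnd w ∧ j ≤ yEnd w := by
  obtain ⟨-, k, hk, rfl, h⟩ := h
  have hx := xEnd_take_mono w (show k + 1 ≤ w.length by omega)
  have hy := yEnd_take_mono w (show k + 1 ≤ w.length by omega)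
  rw [List.take_length] at hx hy
  rcases h with ⟨hs, h⟩ | ⟨hs, h⟩ <;>
  · rw [take_succ_of_getElem?_eq hs] at hx hy
    simp [xEnd, yEnd] at *
    omega

/-- The lower triangles between the path and the diagonal. -/
def lowerTriangles (w : List Letter) : Finset (ℕ × ℕ) :=
  (Finset.range (w.length + 1) ×ˢ Finset.range (w.length + 1)).filter
    fun ij => IsLowerTriangle w ij.1 ij.2

theorem mem_lowerTriangles {w : List Letter} {ij : ℕ × ℕ} :
    ij ∈ lowerTriangles w ↔ IsLowerTriangle w ij.1 ij.2 := by
  refine Finset.mem_filter.trans (and_iff_right_of_imp fun h => ?_)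
  have h1 := h.bounds
  have h2 := xEnd_le_length w
  have h3 := yEnd_le_length w
  rw [Finset.mem_product, Finset.mem_range, Finset.mem_range]
  omega

theorem area_append_singleton (w : List Letter) (x : Letter) :
    area (w ++ [x]) = area w + (columnTop w x - (xEnd w + 1)) := by
  have h : lowerTriangles (w ++ [x]) =
      lowerTriangles w ∪ {xEnd w} ×ˢ Finset.Ico (xEnd w + 1) (columnTop w x) := by
    ext ij
    rw [Finset.mem_union, mem_lowerTriangles, mem_lowerTriangles,
      isLowerTriangle_append_singleton, Finset.mem_product, Finset.mem_singleton, Finset.mem_Ico]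
    refine or_congr Iff.rfl (and_congr_right fun e => ?_)
    rw [e]
  have hd : Disjoint (lowerTriangles w)
      ({xEnd w} ×ˢ Finset.Ico (xEnd w + 1) (columnTop w x)) := by
    rw [Finset.disjoint_left]
    intro ij h1 h2
    have h3 := (mem_lowerTriangles.1 h1).bounds.1
    rw [Finset.mem_product, Finset.mem_singleton] at h2
    omega
  change (lowerTriangles (w ++ [x])).card = (lowerTriangles w).card + _
  rw [h, Finset.card_union_of_disjoint hd, Finset.card_product, Finset.card_singleton, one_mul,
    Nat.card_Ico]

/-- Let `u`, `h`, `δ` count the letters `U`, `H`, `D` of the tail. A leading `U` adds a column of `δ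
- u - 1` triangles and the follow count `h + δ`; a leading `H` adds `δ - u` triangles and the follow
count `δ`. The discrepancies `u + 1 + h` and `u` accumulate to the two correction terms; the factor
2 clears the halved product. -/
theorem two_mul_area_mirror {p : List Letter} (h : SuffixDominated p) :
    2 * area (mirror p) + p.count Letter.U * (p.count Letter.U + 1) +
      2 * (p.count Letter.U * p.count Letter.H) = 2 * ((uCounts p).sum + (hCounts p).sum) := by
  induction p with
  | nil => rfl
  | cons x p ih =>
    have ih' := ih h.of_cons
    have hle := h.count_le
    have hle' := h.of_cons.count_le
    rw [mirror_cons, area_append_singleton]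
    have ex : xEnd (mirror p) = p.count Letter.H + p.count Letter.U := by
      rw [xEnd, count_mirror, count_mirror]
      rfl
    have ey : yEnd (mirror p) = p.count Letter.D + p.count Letter.H := by
      rw [yEnd, count_mirror, count_mirror]
      rfl
    cases x
    · have hlt : p.count Letter.U + 1 ≤ p.count Letter.D := by simpa using hle
      obtain ⟨e, he⟩ := Nat.exists_eq_add_of_le hlt
      have et : columnTop (mirror p) (mirrorLetter Letter.U) - (xEnd (mirror p) + 1) = e := by
        simp only [mirrorLetter, columnTop]
        omega
      rw [et]
      simp only [uCounts_U, hCounts_U, List.sum_cons, List.count_cons_self,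
        List.count_cons_of_ne (show Letter.U ≠ Letter.H by decide), he]
      linear_combination ih'
    · obtain ⟨e, he⟩ := Nat.exists_eq_add_of_le hle'
      have et : columnTop (mirror p) (mirrorLetter Letter.H) - (xEnd (mirror p) + 1) = e := by
        simp only [mirrorLetter, columnTop]
        omega
      rw [et]
      simp only [uCounts_H, hCounts_H, List.sum_cons, List.count_cons_self,
        List.count_cons_of_ne (show Letter.H ≠ Letter.U by decide), he]
      linear_combination ih'
    · have et : columnTop (mirror p) (mirrorLetter Letter.D) - (xEnd (mirror p) + 1) = 0 := by
        simp [mirrorLetter, columnTop]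
      rw [et]
      simpa using ih'

theorem area_mirror_eq_level {n d : ℕ} {p : List Letter} (hp : p ∈ Schroder n d) :
    (area (mirror p) : ℤ) = level (phi n d p) := by
  have h := two_mul_area_mirror (mem_Schroder_iff.1 hp).2.2.2
  rw [hp.1, hp.2.2.1, ← ofFn_phi_inl hp, ← ofFn_phi_inr hp, List.sum_ofFn, List.sum_ofFn,
    Finset.sum_add_distrib] at h
  have hh : height (phi n d p) =
      ∑ j, phi n d p (Sum.inl j) + ∑ i, phi n d p (Sum.inr i) := Fintype.sum_sum_type _
  simp only [Finset.sum_const, Finset.card_univ, Fintype.card_fin, smul_eq_mul, mul_one] at h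
  have h' : 2 * area (mirror p) + n * (n + 1) + 2 * (n * d) =
      2 * (height (phi n d p) + n) := by
    rw [hh, h]
    ring
  -- Over `ℚ` the binomial coefficients become polynomials, and the correction `n(n-1)/2 + nd` is
  -- recognised as their difference in `level`.
  have hq : (2 * area (mirror p) + n * (n + 1) + 2 * (n * d) : ℚ) =
      2 * (height (phi n d p) + n) := by exact_mod_cast h'
  have : (area (mirror p) : ℚ) = (level (phi n d p) : ℚ) := by
    rw [level]
    push_cast
    rw [Nat.cast_choose_two, Nat.cast_choose_two]
    push_cast
    linear_combination hq / 2
  exact_mod_cast this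

end Sandpile

theorem mainTheorem1 (n d : ℕ) :
    Set.BijOn (Sandpile.phi n d) (Sandpile.Schroder n d) (Sandpile.SortedRec n d) ∧
    ∀ c ∈ Sandpile.SortedRec n d, ∀ w : List Sandpile.Letter,
      w = Sandpile.mirror (Sandpile.phiInv n d c) →
        w ∈ Sandpile.Schroder n d ∧
        (Sandpile.area w : ℤ) = Sandpile.level c ∧
        (Sandpile.bounceSch w : ℤ) = (Sandpile.wtoppleITC c : ℤ) - ((n : ℤ) + (d : ℤ)) := by
  refine ⟨Sandpile.phi_bijOn, ?_⟩
  rintro c hc w rfl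
  obtain ⟨hp, hphi⟩ := Sandpile.phiInv_mem_and_phi_phiInv hc
  refine ⟨Sandpile.mirror_mem_Schroder hp, ?_, ?_⟩
  · rw [Sandpile.area_mirror_eq_level hp, hphi]
  · rw [Sandpile.bounceSch_mirror hp, ← hphi, Sandpile.wtoppleITC_phi hp, hphi]
    push_cast
    ring
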